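/- A convex body is a compact convex subset of $\mathbb{R}^2$ with nonempty interior. For compact convex $K,L\subset[0,1]^2$ let $\delta_N(K,L)$ be the area of the symmetric difference $(K\setminus L)\cup(L\setminus K)$ (the Nikodym distance; the subscript is part of the name). Let $L_0,L_1,\dots$ be the polynomials obtained from $1,x,x^2,\dots$ by Gram--Schmidt orthonormalization in $L^2([0,1])$, and for $i,j\in\mathbb{N}_0$ let $\mu_{ij}(K)=\int_K x_1^i x_2^j\,d(x_1,x_2)$ and $\lambda_{ij}(K)=\int_K L_i(x_1)L_j(x_2)\,d(x_1,x_2)$ be the geometric and the Legendre moments of $K$. For $m\ge 3$ let $\mathcal{P}^{(m)}$ be the set of (possibly degenerate, nonempty) convex polygons contained in $[0,1]^2$ with at most $m$ vertices. For $N\in\mathbb{N}_0$, a least squares estimator of $K$ on $\mathcal{P}^{(m)}$ with respect to the first $(N+1)^2$ geometric (respectively Legendre) moments is a polygon in $\mathcal{P}^{(m)}$ that minimizes $\sum_{i,j=0}^N(\mu_{ij}(K)-\mu_{ij}(P))^2$ (respectively $\sum_{i,j=0}^N(\lambda_{ij}(K)-\lambda_{ij}(P))^2$) over $P\in\mathcal{P}^{(m)}$.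 Theorem. There are absolute constants $a_0,a_1>0$ such that for every convex body $K\subset[0,1]^2$, every $m\ge 3$ and every $N\in\mathbb{N}_0$ the following holds. If $\hat P_m$ is a least squares estimator of $K$ on $\mathcal{P}^{(m)}$ with respect to the first $(N+1)^2$ geometric moments, then \[ \delta_N(\hat P_m,K)\le a_0(n+1)^2e^{7(n+1)}\left(1+\tfrac12\ln(2n+1)\right)^2\frac{8\pi^3+16\pi}{m^2}+\frac{a_1}{n+1}\qquad\text{for } n=0,\dots,N. \] If $\hat P^L_m$ is a least squares estimator of $K$ on $\mathcal{P}^{(m)}$ with respect to the first $(N+1)^2$ Legendre moments, then \[ \delta_N(\hat P^L_m,K)\le\frac{8\pi^3+16\pi}{m^2}+\frac{a_1}{N+1}. \] -/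

import Mathlib

open MeasureTheory

namespace MomentLSQ

/-! ### Convex bodies, the unit square and the Nikodym distance

The plane is `ℝ × ℝ` with its Lebesgue measure. Only its topology, its affine structure and
its Lebesgue measure are used, never the norm. -/

/-- A convex body in the plane: compact, convex, with nonempty interior. -/
def IsConvexBody (K : Set (ℝ × ℝ)) : Prop :=
  IsCompact K ∧ Convex ℝ K ∧ (interior K).Nonempty

/-- The unit square `[0,1]²`. -/
def unitSquare : Set (ℝ × ℝ) := Set.Icc 0 1 ×ˢ Set.Icc 0 1

/-- The Nikodym distance: the area of the symmetric difference. -/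
noncomputable def nikodymDist (K L : Set (ℝ × ℝ)) : ℝ :=
  volume.real ((K \ L) ∪ (L \ K))

/-! ### Shifted, normalized Legendre polynomials -/

/-- The `L²([0,1])` inner product on real polynomials. -/
@[reducible] noncomputable def polyInnerCore : InnerProductSpace.Core ℝ (Polynomial ℝ) where
  inner p q := ∫ x in (0 : ℝ)..1, p.eval x * q.eval x
  conj_inner_symm p q := by simp [mul_comm]
  re_inner_nonneg p := by
    simpa using intervalIntegral.integral_nonneg (μ := volume) zero_le_one
      (fun x _ => mul_self_nonneg (p.eval x))
  add_left p q r := by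
    simp only [Polynomial.eval_add, add_mul]
    exact intervalIntegral.integral_add
      ((p.continuous.mul r.continuous).intervalIntegrable _ _)
      ((q.continuous.mul r.continuous).intervalIntegrable _ _)
  smul_left p q r := by
    simp [mul_assoc]
  definite p h := by
    by_contra hp
    have hfin : {x : ℝ | p.IsRoot x}.Finite := Polynomial.finite_setOfPred_isRoot hp
    obtain ⟨c, hc, hroot⟩ :=
      ((Set.Icc_infinite (zero_lt_one (α := ℝ))).sdiff hfin).nonempty
    have hpos : 0 < ∫ x in (0 : ℝ)..1, p.eval x * p.eval x :=
      intervalIntegral.integral_pos zero_lt_one (p.continuous.mul p.continuous).continuousOn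
        (fun x _ => mul_self_nonneg _) ⟨c, hc, mul_self_pos.2 hroot⟩
    exact hpos.ne' h

/-- The shifted normalized Legendre polynomial `Lᵢ`: the `i`-th polynomial obtained from
`1, x, x², …` by Gram-Schmidt orthonormalization in `L²([0,1])`. -/
noncomputable def legendre (i : ℕ) : Polynomial ℝ :=
  letI : NormedAddCommGroup (Polynomial ℝ) := polyInnerCore.toNormedAddCommGroup
  letI : InnerProductSpace ℝ (Polynomial ℝ) := InnerProductSpace.ofCore polyInnerCore.toCore
  InnerProductSpace.gramSchmidtNormed ℝ (fun n : ℕ => (Polynomial.X : Polynomial ℝ) ^ n) i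

/-! ### Moments -/

/-- The geometric moment `μᵢⱼ(K) = ∫_K x₁ⁱ x₂ʲ dx`. -/
noncomputable def geometricMoment (i j : ℕ) (K : Set (ℝ × ℝ)) : ℝ :=
  ∫ x in K, x.1 ^ i * x.2 ^ j

/-- The Legendre moment `λᵢⱼ(K) = ∫_K Lᵢ(x₁) Lⱼ(x₂) dx`. -/
noncomputable def legendreMoment (i j : ℕ) (K : Set (ℝ × ℝ)) : ℝ :=
  ∫ x in K, (legendre i).eval x.1 * (legendre j).eval x.2

/-! ### Polygons and least squares estimators -/

/-- The convex polygons contained in the unit square with at most `m` vertices. A polygon is the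
convex hull of a nonempty finite set of points (possibly degenerate: a segment or a point);
its vertices are its extreme points. -/
def polygons (m : ℕ) : Set (Set (ℝ × ℝ)) :=
  {P | (∃ s : Set (ℝ × ℝ), s.Finite ∧ s.Nonempty ∧ P = convexHull ℝ s) ∧
    P ⊆ unitSquare ∧ (P.extremePoints ℝ).ncard ≤ m}

/-- The sum of squared differences of the first `(N+1)²` moments of `K` and `P`, for a
family of moments `M`. -/
noncomputable def momentError (M : ℕ → ℕ → Set (ℝ × ℝ) → ℝ) (N : ℕ) (K P : Set (ℝ × ℝ)) : ℝ :=
  ∑ i ∈ Finset.range (N + 1), ∑ j ∈ Finset.range (N + 1), (M i j K - M i j P) ^ 2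

/-- `P` is a least squares estimator of `K` with respect to the first `(N+1)²` moments `M` on
the space of convex polygons in the unit square with at most `m` vertices. -/
def IsLeastSquaresEstimator (M : ℕ → ℕ → Set (ℝ × ℝ) → ℝ) (N m : ℕ) (K P : Set (ℝ × ℝ)) : Prop :=
  P ∈ polygons m ∧ ∀ Q ∈ polygons m, momentError M N K P ≤ momentError M N K Q

end MomentLSQ

namespace MomentLSQ

/-! ### Legendre polynomials -/

/-! Let `D` be the difference of the indicators of `K` and `P`. It takes values in {-1, 0, 1}, so
the Nikodym distance is the squared norm of `D` in L² of the unit square, and differences of moments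
are inner products of `D` with product functions.

Legendre case. The products of Legendre polynomials are orthonormal, so by Bessel the moment error
is at most the distance (`legendreMomentError_le`). Conversely, the distance exceeds the moment
error only by the squared norm of the part of `D` orthogonal to those products, which is at most
24/(N+1) (`nikodymDist_le_legendreMomentError_add`). Indeed the slices of a convex set are
intervals. The substitution x = (1 - cos t)/2 turns polynomials of degree N into cosine sums, and
the Fourier tail of the indicator of an interval is O(1/N) (`exists_polynomial_approx`). Slicewise
estimates in both variables combine to a planar one (`integral_sq_le_sum_add`). If `Q` is an
inscribed polygon close to `K`, minimality gives distance(P) ≤ error(P) + tail ≤ error(Q) + tail ≤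
distance(Q) + tail.

Such a `Q` comes from `exists_polygon_volume`: join the endpoints of vertical sections at
cosine-spaced abscissae and average the inscribed trapezoid sums over all shifts of the nodes. The
average misses the area of `K` by O(1/m²), so some shift does at least as well.

Geometric case. Hilbert's inequality bounds the moment error of `Q` by 16 times its distance
(`geometricMomentError_le`). Passing from geometric to Legendre moments up to degree n costs a
factor 4608^(2(n+1)) (`legendreMomentError_le_geometricMomentError`), obtained by duality from a
bound on polynomial coefficients in terms of the L² norm. This base exceeds e^7, but the estimate
holds for every degree up to N. Using it at degree n/3 brings the growth below e^(7(n+1)), since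
4608² ≤ e^21, and only triples the constant in the tail. The remaining factors in n of the stated
bound are at least 1. -/

theorem integral_legendre_mul_legendre (i j : ℕ) :
    ∫ x in (0 : ℝ)..1, (legendre i).eval x * (legendre j).eval x = if i = j then 1 else 0 := by
  let _ : NormedAddCommGroup (Polynomial ℝ) := polyInnerCore.toNormedAddCommGroup
  let _ : InnerProductSpace ℝ (Polynomial ℝ) := InnerProductSpace.ofCore polyInnerCore.toCore
  have hli : LinearIndependent ℝ (fun n : ℕ => (Polynomial.X : Polynomial ℝ) ^ n) := by
    have := (Polynomial.basisMonomials ℝ).linearIndependent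
    simpa [Polynomial.coe_basisMonomials, Polynomial.monomial_one_right_eq_X_pow] using this
  have h := orthonormal_iff_ite.1 (InnerProductSpace.gramSchmidtNormed_orthonormal (𝕜 := ℝ) hli) i j
  exact h

/-- Gram-Schmidt preserves the spans of initial segments. Both the degree bound on the Legendre
polynomials and the Legendre expansion of an arbitrary polynomial rest on this. -/
theorem span_legendre (n : ℕ) :
    Submodule.span ℝ (legendre '' Set.Iic n) = Polynomial.degreeLE ℝ n := by
  let _ : NormedAddCommGroup (Polynomial ℝ) := polyInnerCore.toNormedAddCommGroup
  let _ : InnerProductSpace ℝ (Polynomial ℝ) := InnerProductSpace.ofCore polyInnerCore.toCore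
  have h1 : Submodule.span ℝ (legendre '' Set.Iic n) = _ :=
    InnerProductSpace.span_gramSchmidtNormed (𝕜 := ℝ)
      (fun n : ℕ => (Polynomial.X : Polynomial ℝ) ^ n) (Set.Iic n)
  have h2 := InnerProductSpace.span_gramSchmidt_Iic (𝕜 := ℝ)
      (fun n : ℕ => (Polynomial.X : Polynomial ℝ) ^ n) n
  rw [h1, h2, Polynomial.degreeLE_eq_span_X_pow]
  congr 1
  ext p
  simp

theorem natDegree_legendre_le (i : ℕ) : (legendre i).natDegree ≤ i := by
  have : legendre i ∈ Polynomial.degreeLE ℝ i := by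
    rw [← span_legendre]
    exact Submodule.subset_span ⟨i, Set.self_mem_Iic, rfl⟩
  exact Polynomial.natDegree_le_of_degree_le (Polynomial.mem_degreeLE.1 this)

theorem exists_eq_sum_legendre {n : ℕ} {p : Polynomial ℝ} (hp : p.natDegree ≤ n) :
    ∃ b : ℕ → ℝ, ∀ x, p.eval x = ∑ i ∈ Finset.range (n + 1), b i * (legendre i).eval x := by
  have hmem : p ∈ Submodule.span ℝ (legendre '' (Finset.range (n + 1) : Set ℕ)) := by
    have hset : ((Finset.range (n + 1) : Finset ℕ) : Set ℕ) = Set.Iic n := by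
      ext; simp
    rw [hset, span_legendre, Polynomial.mem_degreeLE]
    exact Polynomial.degree_le_of_natDegree_le hp
  obtain ⟨b, hb⟩ := (Submodule.mem_span_image_finset_iff_exists_fun ℝ).1 hmem
  refine ⟨fun i => if h : i ∈ Finset.range (n + 1) then b ⟨i, h⟩ else 0, fun x => ?_⟩
  rw [← hb, Polynomial.eval_finsetSum, Finset.univ_eq_attach,
    ← Finset.sum_attach (Finset.range (n + 1))]
  refine Finset.sum_congr rfl fun i _ => ?_
  simp only [i.2, dif_pos, Polynomial.eval_smul, smul_eq_mul]

/-! ### Coefficients of a polynomial bounded on the unit interval -/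

theorem abs_coeff_prod_X_sub_C_le (s : Finset ℕ) (r : ℕ → ℝ) (i : ℕ) :
    |(∏ j ∈ s, (Polynomial.X - Polynomial.C (r j))).coeff i| ≤ ∏ j ∈ s, (1 + |r j|) := by
  induction s using Finset.induction_on generalizing i with
  | empty =>
    simp only [Finset.prod_empty, Polynomial.coeff_one]
    split_ifs <;> simp
  | insert a s ha ih =>
    rw [Finset.prod_insert ha, Finset.prod_insert ha, sub_mul, Polynomial.coeff_sub,
      Polynomial.coeff_C_mul, add_mul, one_mul]
    refine (abs_sub _ _).trans (add_le_add ?_ ?_)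
    · cases i with
      | zero => simpa using Finset.prod_nonneg fun j _ => by positivity
      | succ i => rw [Polynomial.coeff_X_mul]; exact ih i
    · rw [abs_mul]
      exact mul_le_mul_of_nonneg_left (ih i) (abs_nonneg _)

theorem prod_erase_abs_sub {N k : ℕ} (hk : k ≤ N) :
    ∏ j ∈ (Finset.range (N + 1)).erase k, |(k : ℝ) - j| = k.factorial * (N - k).factorial := by
  obtain ⟨m, rfl⟩ := Nat.exists_eq_add_of_le hk
  have h1 : ∏ j ∈ (Finset.range (k + m + 1)).erase k, |(k : ℝ) - j|
      = ∏ j ∈ Finset.range (k + (m + 1)), if j = k then 1 else |(k : ℝ) - j| := by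
    rw [← Finset.mul_prod_erase (Finset.range (k + (m + 1))) _ (a := k) (by simp)]
    rw [if_pos rfl, one_mul]
    exact Finset.prod_congr rfl fun j hj => by rw [if_neg (Finset.ne_of_mem_erase hj)]
  rw [h1, Finset.prod_range_add, Finset.prod_range_succ', add_tsub_cancel_left]
  congr 1
  · rw [← Finset.prod_range_reflect, ← Finset.prod_range_add_one_eq_factorial, Nat.cast_prod]
    refine Finset.prod_congr rfl fun j hj => ?_
    have hj' := Finset.mem_range.1 hj
    rw [if_neg (by omega), Nat.cast_sub (by omega), Nat.cast_sub (by omega)]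
    push_cast
    rw [show (k : ℝ) - (k - 1 - j) = j + 1 by ring, abs_of_nonneg (by positivity)]
  · simp only [add_zero, if_true, mul_one]
    rw [← Finset.prod_range_add_one_eq_factorial, Nat.cast_prod]
    refine Finset.prod_congr rfl fun j hj => ?_
    rw [if_neg (by omega)]
    push_cast
    rw [show (k : ℝ) - (k + (j + 1)) = -(j + 1) by ring, abs_neg, abs_of_nonneg (by positivity)]

/-- The numerator is a product of N linear factors with roots in [0, 1], so its coefficients are at
most 2^N. The reciprocal of the denominator is N^N / (k! (N-k)!), that is, N^N / N! ≤ e^N ≤ 3^N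
times a binomial coefficient of size at most 2^N. Hence 12 = 2 · 3 · 2. -/
theorem abs_coeff_lagrange_basis_le {N k : ℕ} (hN : 0 < N) (hk : k ≤ N) (i : ℕ) :
    |(Lagrange.basis (Finset.range (N + 1)) (fun j : ℕ => (j : ℝ) / N) k).coeff i| ≤ 12 ^ N := by
  have hN' : (0 : ℝ) < N := by exact_mod_cast hN
  have hcard : ((Finset.range (N + 1)).erase k).card = N := by
    rw [Finset.card_erase_of_mem (by simp; omega)]; simp
  simp only [Lagrange.basis, Lagrange.basisDivisor, Finset.prod_mul_distrib]
  rw [← map_prod, Polynomial.coeff_C_mul, abs_mul]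
  have h1 : |∏ j ∈ (Finset.range (N + 1)).erase k, ((k : ℝ) / N - j / N)⁻¹|
      = N ^ N / (k.factorial * (N - k).factorial) := by
    rw [Finset.abs_prod, ← prod_erase_abs_sub hk]
    have : ∀ j ∈ (Finset.range (N + 1)).erase k,
        |((k : ℝ) / N - j / N)⁻¹| = N / |(k : ℝ) - j| := fun j _ => by
      rw [← sub_div, inv_div, abs_div, abs_of_pos hN']
    rw [Finset.prod_congr rfl this, Finset.prod_div_distrib, Finset.prod_const, hcard]
  have h2 : |(∏ j ∈ (Finset.range (N + 1)).erase k,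
      (Polynomial.X - Polynomial.C ((j : ℝ) / N))).coeff i| ≤ 2 ^ N := by
    refine (abs_coeff_prod_X_sub_C_le _ _ i).trans ?_
    calc _ ≤ ∏ j ∈ (Finset.range (N + 1)).erase k, (2 : ℝ) := by
          refine Finset.prod_le_prod (fun j _ => by positivity) fun j hj => ?_
          have hj' : (j : ℝ) ≤ N := by
            have := Finset.mem_range.1 (Finset.mem_of_mem_erase hj)
            exact_mod_cast Nat.lt_succ_iff.1 this
          rw [abs_of_nonneg (by positivity)]
          have := (div_le_one hN').2 hj'
          linarith
      _ = 2 ^ N := by rw [Finset.prod_const, hcard]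
  have h3 : (N : ℝ) ^ N / (k.factorial * (N - k).factorial) ≤ 6 ^ N := by
    have hch : (N.choose k : ℝ) ≤ 2 ^ N := by exact_mod_cast Nat.choose_le_two_pow N k
    have hfac : (N.choose k : ℝ) * (k.factorial * (N - k).factorial) = N.factorial := by
      rw [← mul_assoc]; exact_mod_cast Nat.choose_mul_factorial_mul_factorial hk
    have hexp : (N : ℝ) ^ N / N.factorial ≤ 3 ^ N := by
      refine (Real.pow_div_factorial_le_exp (N : ℝ) hN'.le N).trans ?_
      rw [← Real.exp_one_pow]
      exact pow_le_pow_left₀ (Real.exp_pos 1).le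
        (Real.exp_one_lt_d9.le.trans (by norm_num)) N
    have hf : (0 : ℝ) < k.factorial * (N - k).factorial := by positivity
    rw [div_le_iff₀ (by positivity)] at hexp
    rw [div_le_iff₀ hf, show (6 : ℝ) = 3 * 2 by norm_num, mul_pow, mul_assoc]
    refine hexp.trans (mul_le_mul_of_nonneg_left ?_ (by positivity))
    rw [← hfac]
    exact mul_le_mul_of_nonneg_right hch hf.le
  rw [h1, show (12 : ℝ) = 6 * 2 by norm_num, mul_pow]
  exact mul_le_mul h3 h2 (abs_nonneg _) (by positivity)

/-- Interpolate `p` at the N+1 equispaced nodes. Each node contributes at most 12^N M, and the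
number of nodes is absorbed by N + 1 ≤ 2^N. -/
theorem abs_coeff_le_of_abs_eval_le {N : ℕ} (hN : 0 < N) {p : Polynomial ℝ}
    (hp : p.natDegree ≤ N) {M : ℝ} (hM : ∀ x ∈ Set.Icc (0 : ℝ) 1, |p.eval x| ≤ M) (i : ℕ) :
    |p.coeff i| ≤ 24 ^ N * M := by
  have hN' : (0 : ℝ) < N := by exact_mod_cast hN
  have hM0 : 0 ≤ M := (abs_nonneg _).trans (hM 0 (by simp))
  have hinj : Set.InjOn (fun j : ℕ => (j : ℝ) / N) (Finset.range (N + 1) : Set ℕ) := by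
    intro a _ b _ hab
    have := (div_left_inj' hN'.ne').1 hab
    exact_mod_cast this
  have hdeg : p.degree < (Finset.range (N + 1)).card := by
    rw [Finset.card_range]
    exact (Polynomial.degree_le_of_natDegree_le hp).trans_lt (by exact_mod_cast Nat.lt_succ_self N)
  rw [Lagrange.eq_interpolate hinj hdeg, Lagrange.interpolate_apply, Polynomial.finsetSum_coeff]
  calc _ ≤ ∑ k ∈ Finset.range (N + 1), M * 12 ^ N := by
        refine (Finset.abs_sum_le_sum_abs _ _).trans (Finset.sum_le_sum fun k hk => ?_)
        have hk' : k ≤ N := Nat.lt_succ_iff.1 (Finset.mem_range.1 hk)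
        rw [Polynomial.coeff_C_mul, abs_mul]
        refine mul_le_mul (hM _ ⟨by positivity, (div_le_one hN').2 (by exact_mod_cast hk')⟩)
          (abs_coeff_lagrange_basis_le hN hk' i) (abs_nonneg _) hM0
    _ = (N + 1 : ℕ) * 12 ^ N * M := by
        rw [Finset.sum_const, Finset.card_range, nsmul_eq_mul]; ring
    _ ≤ 24 ^ N * M := by
        refine mul_le_mul_of_nonneg_right ?_ hM0
        rw [show (24 : ℝ) = 2 * 12 by norm_num, mul_pow]
        refine mul_le_mul_of_nonneg_right ?_ (by positivity)
        exact_mod_cast Nat.lt_two_pow_self (n := N)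

/-! ### Square integrable functions and the Cauchy-Schwarz inequality -/

theorem sq_integral_mul_le {α : Type*} [MeasurableSpace α] {μ : Measure α} {f g : α → ℝ}
    (hf : MemLp f 2 μ) (hg : MemLp g 2 μ) :
    (∫ x, f x * g x ∂μ) ^ 2 ≤ (∫ x, f x ^ 2 ∂μ) * ∫ x, g x ^ 2 ∂μ := by
  have hfg : Integrable (fun x => f x * g x) μ := hf.integrable_mul hg
  have key : ∀ t : ℝ, 0 ≤ (∫ x, g x ^ 2 ∂μ) * (t * t) + (2 * ∫ x, f x * g x ∂μ) * t
      + ∫ x, f x ^ 2 ∂μ := fun t => by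
    have h0 : 0 ≤ ∫ x, (f x + t * g x) ^ 2 ∂μ := integral_nonneg fun x => sq_nonneg _
    have h1 : ∫ x, (f x + t * g x) ^ 2 ∂μ
        = ∫ x, (f x ^ 2 + 2 * t * (f x * g x) + t ^ 2 * g x ^ 2) ∂μ := by
      congr 1; ext x; ring
    have h2 : Integrable (fun x => f x ^ 2 + 2 * t * (f x * g x)) μ :=
      hf.integrable_sq.add (hfg.const_mul _)
    rw [h1, integral_add h2 (hg.integrable_sq.const_mul _), integral_add hf.integrable_sq
      (hfg.const_mul _), integral_const_mul, integral_const_mul] at h0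
    linarith
  have := discrim_le_zero key
  rw [discrim] at this
  linarith

/-- Lebesgue measure on the unit interval. -/
noncomputable abbrev unitVolume : Measure ℝ := volume.restrict (Set.Icc 0 1)

theorem integral_unitVolume (f : ℝ → ℝ) : ∫ x, f x ∂unitVolume = ∫ x in (0 : ℝ)..1, f x := by
  rw [intervalIntegral.integral_of_le zero_le_one, integral_Icc_eq_integral_Ioc]

theorem memLp_unitVolume_of_continuous {f : ℝ → ℝ} (hf : Continuous f) :
    MemLp f 2 unitVolume := by
  obtain ⟨C, hC⟩ := (isCompact_Icc (a := (0 : ℝ)) (b := 1)).exists_bound_of_continuousOn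
    hf.continuousOn
  exact MemLp.of_bound hf.aestronglyMeasurable C
    ((ae_restrict_iff' measurableSet_Icc).2 (Filter.Eventually.of_forall hC))

theorem memLp_unitVolume_of_bound {f : ℝ → ℝ} (hf : Measurable f) {C : ℝ}
    (hC : ∀ x, |f x| ≤ C) : MemLp f 2 unitVolume :=
  MemLp.of_bound hf.aestronglyMeasurable C (Filter.Eventually.of_forall hC)

/-! ### Coefficients of polynomials in terms of their norm -/

/-- The primitive of a polynomial vanishing at the origin. -/
theorem exists_primitive (p : Polynomial ℝ) {n : ℕ} (hp : p.natDegree ≤ n) :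
    ∃ q : Polynomial ℝ, q.natDegree ≤ n + 1 ∧ q.derivative = p ∧ q.eval 0 = 0 := by
  refine ⟨∑ i ∈ Finset.range (n + 1), Polynomial.C (p.coeff i / (i + 1)) * Polynomial.X ^ (i + 1),
    ?_, ?_, ?_⟩
  · refine Polynomial.natDegree_sum_le_of_forall_le _ _ fun i hi => ?_
    exact (Polynomial.natDegree_C_mul_X_pow_le _ _).trans
      (by have := Finset.mem_range.1 hi; omega)
  · conv_rhs => rw [p.as_sum_range_C_mul_X_pow' (n := n + 1) (by omega)]
    rw [Polynomial.derivative_sum]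
    refine Finset.sum_congr rfl fun i _ => ?_
    rw [Polynomial.derivative_C_mul_X_pow]
    congr 2
    push_cast
    field_simp
  · simp [Polynomial.eval_finsetSum]

/-- The interpolation bound needs a supremum norm, so it is applied to the primitive `q`, which
Cauchy-Schwarz bounds on [0, 1] by the L² norm of `p`. Returning to `p` multiplies coefficients by i
+ 1 ≤ n + 1. Summing n + 1 squares gives (n+1)³ · 576^(n+1), where 576 = 24², and (n+1)³ ≤ 8^(n+1)
yields the base 4608. -/
theorem sum_sq_coeff_le {n : ℕ} {p : Polynomial ℝ} (hp : p.natDegree ≤ n) :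
    ∑ i ∈ Finset.range (n + 1), p.coeff i ^ 2
      ≤ 4608 ^ (n + 1) * ∫ x, p.eval x ^ 2 ∂unitVolume := by
  obtain ⟨q, hq, hqp, hq0⟩ := exists_primitive p hp
  set I := ∫ x, p.eval x ^ 2 ∂unitVolume with hI
  have hI0 : 0 ≤ I := integral_nonneg fun x => sq_nonneg _
  have hbound : ∀ x ∈ Set.Icc (0 : ℝ) 1, |q.eval x| ≤ √I := fun x hx => by
    refine Real.abs_le_sqrt ?_
    have h1 : q.eval x = ∫ t in (0 : ℝ)..x, p.eval t := by
      rw [intervalIntegral.integral_eq_sub_of_hasDerivAt (f := fun t => q.eval t)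
        (fun t _ => by have := q.hasDerivAt t; rwa [hqp] at this)
        (p.continuous.intervalIntegrable _ _), hq0, sub_zero]
    have h2 : q.eval x = ∫ t, p.eval t * (Set.Icc 0 x).indicator 1 t ∂unitVolume := by
      have : (fun t => p.eval t * (Set.Icc 0 x).indicator (1 : ℝ → ℝ) t)
          = (Set.Icc 0 x).indicator fun t => p.eval t := by
        ext t; by_cases ht : t ∈ Set.Icc 0 x <;> simp [ht]
      rw [this, integral_indicator measurableSet_Icc, Measure.restrict_restrict measurableSet_Icc,
        Set.inter_eq_left.2 (Set.Icc_subset_Icc_right hx.2), h1,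
        intervalIntegral.integral_of_le hx.1, integral_Icc_eq_integral_Ioc]
    have hmem : MemLp ((Set.Icc 0 x).indicator (1 : ℝ → ℝ)) 2 unitVolume :=
      memLp_unitVolume_of_bound (measurable_one.indicator measurableSet_Icc) (C := 1) fun t => by
        by_cases ht : t ∈ Set.Icc 0 x <;> simp [ht]
    have h3 : ∫ t, (Set.Icc 0 x).indicator (1 : ℝ → ℝ) t ^ 2 ∂unitVolume ≤ 1 := by
      have : (∫ t, (Set.Icc 0 x).indicator (1 : ℝ → ℝ) t ^ 2 ∂unitVolume)
          ≤ ∫ t, (1 : ℝ) ∂unitVolume :=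
        integral_mono hmem.integrable_sq (integrable_const _) fun t => by
          by_cases ht : t ∈ Set.Icc 0 x <;> simp [ht]
      simpa using this
    rw [h2]
    refine (sq_integral_mul_le (memLp_unitVolume_of_continuous p.continuous) hmem).trans ?_
    exact mul_le_of_le_one_right hI0 h3
  have hcoeff : ∀ i ∈ Finset.range (n + 1),
      p.coeff i ^ 2 ≤ ((n : ℝ) + 1) ^ 2 * (576 ^ (n + 1) * I) := fun i hi => by
    have hi' : (i : ℝ) ≤ n := by exact_mod_cast Nat.lt_succ_iff.1 (Finset.mem_range.1 hi)
    have h := abs_coeff_le_of_abs_eval_le n.succ_pos hq hbound (i + 1)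
    have h' := pow_le_pow_left₀ (abs_nonneg _) h 2
    rw [sq_abs, mul_pow, Real.sq_sqrt hI0, ← pow_mul, mul_comm (n + 1), pow_mul] at h'
    norm_num at h'
    rw [← hqp, Polynomial.coeff_derivative, mul_pow, mul_comm]
    exact mul_le_mul (by gcongr) h' (sq_nonneg _) (sq_nonneg _)
  refine (Finset.sum_le_sum hcoeff).trans ?_
  rw [Finset.sum_const, Finset.card_range, nsmul_eq_mul, show (4608 : ℝ) = 2 ^ 3 * 576 by norm_num,
    mul_pow, ← pow_mul, mul_comm 3, pow_mul]
  have h2 : ((n : ℝ) + 1) ≤ 2 ^ (n + 1) := by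
    exact_mod_cast (Nat.lt_two_pow_self (n := n + 1)).le
  have h3 : ((n : ℝ) + 1) ^ 3 ≤ (2 ^ (n + 1)) ^ 3 := by gcongr
  calc _ = ((n : ℝ) + 1) ^ 3 * (576 ^ (n + 1) * I) := by push_cast; ring
    _ ≤ (2 ^ (n + 1)) ^ 3 * (576 ^ (n + 1) * I) :=
        mul_le_mul_of_nonneg_right h3 (by positivity)
    _ = _ := by ring

/-- The change of coordinates from monomial to Legendre moments is bounded. -/
theorem sum_sq_legendre_coeff_mul_le (n : ℕ) (u : ℕ → ℝ) :
    ∑ i ∈ Finset.range (n + 1),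
        (∑ k ∈ Finset.range (n + 1), (legendre i).coeff k * u k) ^ 2
      ≤ 4608 ^ (n + 1) * ∑ k ∈ Finset.range (n + 1), u k ^ 2 := by
  set w : ℕ → ℝ := fun i => ∑ k ∈ Finset.range (n + 1), (legendre i).coeff k * u k with hw
  -- Duality: the polynomial with Legendre coefficients `w` has squared norm `W`, while `W` is also
  -- the pairing of its monomial coefficients with `u`. Cauchy-Schwarz and `sum_sq_coeff_le` give W²
  -- ≤ 4608^(n+1) W U, and one factor W cancels.
  set p : Polynomial ℝ := ∑ i ∈ Finset.range (n + 1), Polynomial.C (w i) * legendre i with hp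
  set W := ∑ i ∈ Finset.range (n + 1), w i ^ 2 with hW
  set U := ∑ k ∈ Finset.range (n + 1), u k ^ 2 with hU
  have hdeg : p.natDegree ≤ n := Polynomial.natDegree_sum_le_of_forall_le _ _ fun i hi =>
    (Polynomial.natDegree_C_mul_le _ _).trans ((natDegree_legendre_le i).trans
      (Nat.lt_succ_iff.1 (Finset.mem_range.1 hi)))
  have hnorm : ∫ x, p.eval x ^ 2 ∂unitVolume = W := by
    have h1 : ∀ x, p.eval x ^ 2 = ∑ i ∈ Finset.range (n + 1), ∑ j ∈ Finset.range (n + 1),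
        w i * w j * ((legendre i).eval x * (legendre j).eval x) := fun x => by
      rw [hp, Polynomial.eval_finsetSum, sq, Finset.sum_mul_sum]
      refine Finset.sum_congr rfl fun i _ => Finset.sum_congr rfl fun j _ => ?_
      simp only [Polynomial.eval_mul, Polynomial.eval_C]
      ring
    have hint : ∀ i j, IntervalIntegrable
        (fun x => w i * w j * ((legendre i).eval x * (legendre j).eval x)) volume 0 1 := fun i j =>
      (continuous_const.mul ((legendre i).continuous.mul
        (legendre j).continuous)).intervalIntegrable _ _
    simp_rw [h1]
    rw [integral_unitVolume, intervalIntegral.integral_finsetSum fun i _ =>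
      (by fun_prop : Continuous fun x => ∑ j ∈ Finset.range (n + 1),
        w i * w j * ((legendre i).eval x * (legendre j).eval x)).intervalIntegrable _ _]
    refine Finset.sum_congr rfl fun i hi => ?_
    rw [intervalIntegral.integral_finsetSum fun j _ => hint i j]
    simp_rw [intervalIntegral.integral_const_mul, integral_legendre_mul_legendre]
    simp [Finset.mem_range.1 hi, sq]
  have hpu : W = ∑ k ∈ Finset.range (n + 1), p.coeff k * u k := by
    have hc : ∀ k, p.coeff k = ∑ i ∈ Finset.range (n + 1), w i * (legendre i).coeff k := fun k => by
      rw [hp, Polynomial.finsetSum_coeff]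
      exact Finset.sum_congr rfl fun i _ => Polynomial.coeff_C_mul _
    simp_rw [hc, Finset.sum_mul]
    rw [Finset.sum_comm, hW]
    refine Finset.sum_congr rfl fun i _ => ?_
    rw [sq]
    nth_rewrite 2 [hw]
    rw [Finset.mul_sum]
    exact Finset.sum_congr rfl fun k _ => by ring
  have hW0 : 0 ≤ W := Finset.sum_nonneg fun i _ => sq_nonneg _
  have hU0 : 0 ≤ U := Finset.sum_nonneg fun i _ => sq_nonneg _
  have hcs : W ^ 2 ≤ (4608 ^ (n + 1) * W) * U := by
    nth_rewrite 1 [hpu]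
    refine (Finset.sum_mul_sq_le_sq_mul_sq _ _ _).trans ?_
    refine mul_le_mul_of_nonneg_right ?_ hU0
    rw [← hnorm]
    exact sum_sq_coeff_le hdeg
  rcases hW0.eq_or_lt with h | h
  · change W ≤ _
    rw [← h]; positivity
  · have : W * W ≤ W * (4608 ^ (n + 1) * U) := by linarith
    exact le_of_mul_le_mul_left this h

/-! ### Hilbert's inequality -/

/-- This is the Schur test for the Hilbert matrix with weight 1/√(j+1). For j ≤ i the kernel is at
most 1/(i+1) and the weights telescope against 2√j. For j > i the term is at most (j+1)^(-3/2),
which telescopes against 2/√j. Each range contributes 2/√(i+1). -/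
theorem sum_hilbert_kernel_le (i n : ℕ) :
    ∑ j ∈ Finset.range n, 1 / (((i : ℝ) + j + 1) * √((j : ℝ) + 1)) ≤ 4 / √((i : ℝ) + 1) := by
  have hstep : ∀ n : ℕ, √((n : ℝ) + 1) ^ 2 = n + 1 := fun n => Real.sq_sqrt (by positivity)
  have hpos : ∀ n : ℕ, 0 < √((n : ℝ) + 1) := fun n => Real.sqrt_pos.2 (by positivity)
  have h1 : ∀ n : ℕ, ∑ j ∈ Finset.range n, 1 / (((i : ℝ) + j + 1) * √((j : ℝ) + 1))
      ≤ 2 * √n / (i + 1) := fun n => by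
    induction n with
    | zero => simp
    | succ n ih =>
      rw [Finset.sum_range_succ]
      have hs := hstep n
      have ht : √(n : ℝ) ^ 2 = n := Real.sq_sqrt (by positivity)
      have ht0 := Real.sqrt_nonneg (n : ℝ)
      have hp := hpos n
      have hterm : 1 / (((i : ℝ) + n + 1) * √((n : ℝ) + 1))
          ≤ 2 * (√((n : ℝ) + 1) - √n) / (i + 1) := by
        rw [div_le_div_iff₀ (by positivity) (by positivity)]
        have h2 : 1 ≤ 2 * (√((n : ℝ) + 1) - √n) * √((n : ℝ) + 1) := by
          nlinarith [sq_nonneg (√((n : ℝ) + 1) - √n)]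
        have h3 : (0 : ℝ) ≤ n := by positivity
        have h4 : (0 : ℝ) ≤ i := by positivity
        nlinarith
      push_cast
      calc _ ≤ 2 * √n / (i + 1) + 2 * (√((n : ℝ) + 1) - √n) / (i + 1) := add_le_add ih hterm
        _ = _ := by ring
  have h2 : ∀ m : ℕ, ∑ j ∈ Finset.range (i + 1 + m), 1 / (((i : ℝ) + j + 1) * √((j : ℝ) + 1))
      ≤ 4 / √((i : ℝ) + 1) - 2 / √((i : ℝ) + 1 + m) := fun m => by
    induction m with
    | zero =>
      refine (h1 _).trans ?_
      push_cast
      rw [add_zero, ← sub_div]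
      have := hstep i
      have hp := hpos i
      rw [div_le_div_iff₀ (by positivity) hp]
      nlinarith
    | succ m ih =>
      rw [← add_assoc, Finset.sum_range_succ]
      have e1 : √((i : ℝ) + 1 + m) ^ 2 = i + 1 + m := Real.sq_sqrt (by positivity)
      have e2 : √((i : ℝ) + 1 + (m + 1)) ^ 2 = i + 1 + (m + 1) := Real.sq_sqrt (by positivity)
      have p1 : 0 < √((i : ℝ) + 1 + m) := Real.sqrt_pos.2 (by positivity)
      have p2 : 0 < √((i : ℝ) + 1 + (m + 1)) := Real.sqrt_pos.2 (by positivity)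
      push_cast
      rw [add_assoc ((i : ℝ) + 1) (m : ℝ) 1]
      have e0 : (i : ℝ) + (i + 1 + m) + 1 = i + √((i : ℝ) + 1 + (m + 1)) ^ 2 := by rw [e2]; ring
      rw [e0]
      set s := √((i : ℝ) + 1 + m)
      set t := √((i : ℝ) + 1 + (m + 1))
      have hst : s ≤ t := Real.sqrt_le_sqrt (by linarith)
      have hd : t ^ 2 - s ^ 2 = 1 := by rw [e1, e2]; ring
      have h4 : (0 : ℝ) ≤ i := by positivity
      have : 1 / (((i : ℝ) + t ^ 2) * t) ≤ 2 / s - 2 / t := by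
        have h5 : 2 / s - 2 / t = 2 / (s * t * (s + t)) := by
          rw [div_sub_div _ _ p1.ne' p2.ne', div_eq_div_iff (by positivity) (by positivity)]
          linear_combination (2 * s * t) * hd
        rw [h5, div_le_div_iff₀ (by positivity) (by positivity)]
        nlinarith [mul_nonneg h4 p2.le, mul_le_mul_of_nonneg_left hst p1.le,
          mul_le_mul_of_nonneg_left hst p2.le, mul_pos p1 p2]
      linarith
  calc _ ≤ ∑ j ∈ Finset.range (i + 1 + n), 1 / (((i : ℝ) + j + 1) * √((j : ℝ) + 1)) :=
        Finset.sum_le_sum_of_subset_of_nonneg (Finset.range_mono (by omega))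
          fun j _ _ => by positivity
    _ ≤ 4 / √((i : ℝ) + 1) - 2 / √((i : ℝ) + 1 + n) := h2 n
    _ ≤ _ := by linarith [show (0 : ℝ) ≤ 2 / √((i : ℝ) + 1 + n) by positivity]

/-- Hilbert's inequality, with a nonoptimal constant. -/
theorem sum_mul_div_add_le (n : ℕ) (a : ℕ → ℝ) :
    ∑ i ∈ Finset.range n, ∑ j ∈ Finset.range n, a i * a j * (1 / ((i : ℝ) + j + 1))
      ≤ 4 * ∑ i ∈ Finset.range n, a i ^ 2 := by
  have hpos : ∀ n : ℕ, 0 < √((n : ℝ) + 1) := fun n => Real.sqrt_pos.2 (by positivity)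
  set F : ℕ → ℕ → ℝ := fun i j =>
    a i ^ 2 * √((i : ℝ) + 1) * (1 / (((i : ℝ) + j + 1) * √((j : ℝ) + 1))) with hF
  -- Weighted arithmetic-geometric mean: the difference of the two sides is a multiple of (a i s - a
  -- j t)².
  have hterm : ∀ i j : ℕ, a i * a j * (1 / ((i : ℝ) + j + 1)) ≤ (F i j + F j i) / 2 := fun i j => by
    simp only [hF]
    have p1 := hpos i
    have p2 := hpos j
    rw [show (j : ℝ) + i + 1 = i + j + 1 by ring]
    set s := √((i : ℝ) + 1)
    set t := √((j : ℝ) + 1)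
    have hk : (0 : ℝ) < (i : ℝ) + j + 1 := by positivity
    set k := (i : ℝ) + j + 1
    have : (a i ^ 2 * s * (1 / (k * t)) + a j ^ 2 * t * (1 / (k * s))) / 2 - a i * a j * (1 / k)
        = (a i * s - a j * t) ^ 2 / (2 * k * s * t) := by
      field_simp
      ring
    have h0 : 0 ≤ (a i * s - a j * t) ^ 2 / (2 * k * s * t) := by positivity
    linarith
  have hrow : ∀ i, ∑ j ∈ Finset.range n, F i j ≤ 4 * a i ^ 2 := fun i => by
    simp only [hF]
    rw [← Finset.mul_sum]
    have := mul_le_mul_of_nonneg_left (sum_hilbert_kernel_le i n)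
      (show 0 ≤ a i ^ 2 * √((i : ℝ) + 1) by positivity)
    refine this.trans_eq ?_
    have p1 := hpos i
    field_simp
  calc _ ≤ ∑ i ∈ Finset.range n, ∑ j ∈ Finset.range n, (F i j + F j i) / 2 :=
        Finset.sum_le_sum fun i _ => Finset.sum_le_sum fun j _ => hterm i j
    _ = ∑ i ∈ Finset.range n, ∑ j ∈ Finset.range n, F i j := by
        simp_rw [← Finset.sum_div, Finset.sum_add_distrib]
        rw [Finset.sum_comm (f := fun i j => F j i)]
        ring
    _ ≤ ∑ i ∈ Finset.range n, 4 * a i ^ 2 := Finset.sum_le_sum fun i _ => hrow i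
    _ = _ := by rw [Finset.mul_sum]

/-- Duality again: the sum `S` of squares is the inner product of `h` with the polynomial whose
coefficients are the moments `u i`. The squared norm of that polynomial is the Hilbert form of `u`,
at most 4S, so S² ≤ 4S‖h‖². -/
theorem sum_sq_integral_pow_mul_le {h : ℝ → ℝ} (hh : MemLp h 2 unitVolume) (n : ℕ) :
    ∑ i ∈ Finset.range n, (∫ x, x ^ i * h x ∂unitVolume) ^ 2 ≤ 4 * ∫ x, h x ^ 2 ∂unitVolume := by
  set u : ℕ → ℝ := fun i => ∫ x, x ^ i * h x ∂unitVolume with hu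
  set S := ∑ i ∈ Finset.range n, u i ^ 2 with hS
  have hS0 : 0 ≤ S := Finset.sum_nonneg fun i _ => sq_nonneg _
  have hH0 : 0 ≤ ∫ x, h x ^ 2 ∂unitVolume := integral_nonneg fun x => sq_nonneg _
  have hpm : ∀ i : ℕ, MemLp (fun x : ℝ => x ^ i) 2 unitVolume := fun i =>
    memLp_unitVolume_of_continuous (continuous_pow i)
  have hqm : MemLp (fun x : ℝ => ∑ i ∈ Finset.range n, u i * x ^ i) 2 unitVolume :=
    memLp_unitVolume_of_continuous (by fun_prop)
  have h1 : S = ∫ x, (∑ i ∈ Finset.range n, u i * x ^ i) * h x ∂unitVolume := by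
    have hint : ∀ i, Integrable (fun x => u i * (x ^ i * h x)) unitVolume := fun i =>
      ((hpm i).integrable_mul hh).const_mul _
    simp_rw [Finset.sum_mul, mul_assoc]
    rw [integral_finsetSum _ fun i _ => hint i]
    simp_rw [integral_const_mul]
    exact Finset.sum_congr rfl fun i _ => sq _
  have h2 : ∫ x, (∑ i ∈ Finset.range n, u i * x ^ i) ^ 2 ∂unitVolume
      = ∑ i ∈ Finset.range n, ∑ j ∈ Finset.range n, u i * u j * (1 / ((i : ℝ) + j + 1)) := by
    have e : ∀ x : ℝ, (∑ i ∈ Finset.range n, u i * x ^ i) ^ 2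
        = ∑ i ∈ Finset.range n, ∑ j ∈ Finset.range n, u i * u j * x ^ (i + j) := fun x => by
      rw [sq, Finset.sum_mul_sum]
      exact Finset.sum_congr rfl fun i _ => Finset.sum_congr rfl fun j _ => by rw [pow_add]; ring
    simp_rw [e]
    rw [integral_unitVolume, intervalIntegral.integral_finsetSum fun i _ =>
      (by fun_prop : Continuous fun x : ℝ =>
        ∑ j ∈ Finset.range n, u i * u j * x ^ (i + j)).intervalIntegrable _ _]
    refine Finset.sum_congr rfl fun i _ => ?_
    rw [intervalIntegral.integral_finsetSum fun j _ =>
      (by fun_prop : Continuous fun x : ℝ => u i * u j * x ^ (i + j)).intervalIntegrable _ _]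
    refine Finset.sum_congr rfl fun j _ => ?_
    rw [intervalIntegral.integral_const_mul, integral_pow]
    simp
  have h3 : S * S ≤ S * (4 * ∫ x, h x ^ 2 ∂unitVolume) := by
    have := sq_integral_mul_le hqm hh
    rw [← h1, h2] at this
    have h4 := mul_le_mul_of_nonneg_right (sum_mul_div_add_le n u) hH0
    nlinarith
  rcases hS0.eq_or_lt with h0 | h0
  · change S ≤ _
    rw [← h0]; positivity
  · exact le_of_mul_le_mul_left h3 h0

/-! ### Tensor products of orthonormal families -/

/-- Measurable functions with a global bound. -/
def BoundedMeasurable {α : Type*} [MeasurableSpace α] (f : α → ℝ) : Prop :=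
  Measurable f ∧ ∃ C, ∀ x, |f x| ≤ C

namespace BoundedMeasurable

variable {α β : Type*} [MeasurableSpace α] [MeasurableSpace β] {f g : α → ℝ}

theorem const (c : ℝ) : BoundedMeasurable fun _ : α => c :=
  ⟨measurable_const, |c|, fun _ => le_rfl⟩

theorem add (hf : BoundedMeasurable f) (hg : BoundedMeasurable g) :
    BoundedMeasurable fun x => f x + g x := by
  obtain ⟨hf, C, hC⟩ := hf
  obtain ⟨hg, D, hD⟩ := hg
  exact ⟨hf.add hg, C + D, fun x => (abs_add_le _ _).trans (add_le_add (hC x) (hD x))⟩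

theorem sub (hf : BoundedMeasurable f) (hg : BoundedMeasurable g) :
    BoundedMeasurable fun x => f x - g x := by
  obtain ⟨hf, C, hC⟩ := hf
  obtain ⟨hg, D, hD⟩ := hg
  exact ⟨hf.sub hg, C + D, fun x => (abs_sub _ _).trans (add_le_add (hC x) (hD x))⟩

theorem mul (hf : BoundedMeasurable f) (hg : BoundedMeasurable g) :
    BoundedMeasurable fun x => f x * g x := by
  obtain ⟨hf, C, hC⟩ := hf
  obtain ⟨hg, D, hD⟩ := hg
  refine ⟨hf.mul hg, C * D, fun x => ?_⟩
  rw [abs_mul]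
  exact mul_le_mul (hC x) (hD x) (abs_nonneg _) ((abs_nonneg _).trans (hC x))

theorem sq (hf : BoundedMeasurable f) : BoundedMeasurable fun x => f x ^ 2 := by
  simpa only [pow_two] using hf.mul hf

theorem sum {ι : Type*} {s : Finset ι} {F : ι → α → ℝ} (hF : ∀ i, BoundedMeasurable (F i)) :
    BoundedMeasurable fun x => ∑ i ∈ s, F i x := by
  classical
  induction s using Finset.induction_on with
  | empty => simpa using const 0
  | insert a s ha ih => simpa only [Finset.sum_insert ha] using (hF a).add ih

theorem comp (hf : BoundedMeasurable f) {u : β → α} (hu : Measurable u) :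
    BoundedMeasurable fun x => f (u x) := by
  obtain ⟨hf, C, hC⟩ := hf
  exact ⟨hf.comp hu, C, fun x => hC _⟩

theorem integrable (hf : BoundedMeasurable f) (μ : Measure α) [IsFiniteMeasure μ] :
    Integrable f μ := by
  obtain ⟨hf, C, hC⟩ := hf
  exact Integrable.of_bound hf.aestronglyMeasurable C (Filter.Eventually.of_forall hC)

theorem memLp (hf : BoundedMeasurable f) (μ : Measure α) [IsFiniteMeasure μ] :
    MemLp f 2 μ := by
  obtain ⟨hf, C, hC⟩ := hf
  exact MemLp.of_bound hf.aestronglyMeasurable C (Filter.Eventually.of_forall hC)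

theorem integral_left {F : α × β → ℝ} (hF : BoundedMeasurable F) (μ : Measure α)
    [IsFiniteMeasure μ] : BoundedMeasurable fun y => ∫ x, F (x, y) ∂μ := by
  obtain ⟨hF, C, hC⟩ := hF
  exact ⟨(hF.stronglyMeasurable.integral_prod_left' (μ := μ)).measurable, C * μ.real Set.univ,
    fun y => norm_integral_le_of_norm_le_const (f := fun x => F (x, y))
      (Filter.Eventually.of_forall fun x => hC (x, y))⟩

theorem integral_right {F : α × β → ℝ} (hF : BoundedMeasurable F) (ν : Measure β)
    [IsFiniteMeasure ν] : BoundedMeasurable fun x => ∫ y, F (x, y) ∂ν :=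
  (hF.comp measurable_swap).integral_left ν

end BoundedMeasurable

section Orthonormal

variable {α : Type*} [MeasurableSpace α] {μ : Measure α} [IsFiniteMeasure μ] {φ : ℕ → α → ℝ}

theorem integral_sq_sub_sum (hφ : ∀ i, BoundedMeasurable (φ i))
    (ho : ∀ i j, ∫ x, φ i x * φ j x ∂μ = if i = j then 1 else 0) {h : α → ℝ}
    (hh : BoundedMeasurable h) (n : ℕ) (b : ℕ → ℝ) :
    ∫ x, (h x - ∑ i ∈ Finset.range n, b i * φ i x) ^ 2 ∂μ = ∫ x, h x ^ 2 ∂μ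
      - 2 * ∑ i ∈ Finset.range n, b i * ∫ x, φ i x * h x ∂μ + ∑ i ∈ Finset.range n, b i ^ 2 := by
  have e : ∀ x, (h x - ∑ i ∈ Finset.range n, b i * φ i x) ^ 2
      = h x ^ 2 - 2 * ∑ i ∈ Finset.range n, b i * (φ i x * h x)
        + ∑ i ∈ Finset.range n, ∑ j ∈ Finset.range n, b i * b j * (φ i x * φ j x) := fun x => by
    have h1 : ∑ i ∈ Finset.range n, b i * (φ i x * h x)
        = (∑ i ∈ Finset.range n, b i * φ i x) * h x := by
      rw [Finset.sum_mul]; exact Finset.sum_congr rfl fun i _ => by ring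
    have h2 : ∑ i ∈ Finset.range n, ∑ j ∈ Finset.range n, b i * b j * (φ i x * φ j x)
        = (∑ i ∈ Finset.range n, b i * φ i x) ^ 2 := by
      rw [sq, Finset.sum_mul_sum]
      exact Finset.sum_congr rfl fun i _ => Finset.sum_congr rfl fun j _ => by ring
    rw [h1, h2]; ring
  have m1 : ∀ i, BoundedMeasurable fun x => b i * (φ i x * h x) := fun i =>
    (BoundedMeasurable.const _).mul ((hφ i).mul hh)
  have m2 : ∀ i j, BoundedMeasurable fun x => b i * b j * (φ i x * φ j x) := fun i j =>
    (BoundedMeasurable.const _).mul ((hφ i).mul (hφ j))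
  have m3 : BoundedMeasurable fun x => 2 * ∑ i ∈ Finset.range n, b i * (φ i x * h x) :=
    (BoundedMeasurable.const _).mul (.sum m1)
  have m4 : ∀ i, BoundedMeasurable fun x =>
      ∑ j ∈ Finset.range n, b i * b j * (φ i x * φ j x) := fun i => .sum (m2 i)
  have m5 : BoundedMeasurable fun x => ∑ i ∈ Finset.range n,
      ∑ j ∈ Finset.range n, b i * b j * (φ i x * φ j x) := .sum m4
  simp_rw [e]
  rw [integral_add ((hh.sq.sub m3).integrable μ) (m5.integrable μ),
    integral_sub (hh.sq.integrable μ) (m3.integrable μ), integral_const_mul,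
    integral_finsetSum _ fun i _ => (m1 i).integrable μ,
    integral_finsetSum _ fun i _ => (m4 i).integrable μ]
  congr 1
  · simp_rw [integral_const_mul]
  · refine Finset.sum_congr rfl fun i hi => ?_
    rw [integral_finsetSum _ fun j _ => (m2 i j).integrable μ]
    simp_rw [integral_const_mul, ho]
    simp [Finset.mem_range.1 hi, sq]

theorem integral_sq_sub_projection (hφ : ∀ i, BoundedMeasurable (φ i))
    (ho : ∀ i j, ∫ x, φ i x * φ j x ∂μ = if i = j then 1 else 0) {h : α → ℝ}
    (hh : BoundedMeasurable h) (n : ℕ) :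
    ∫ x, (h x - ∑ i ∈ Finset.range n, (∫ t, φ i t * h t ∂μ) * φ i x) ^ 2 ∂μ
      = ∫ x, h x ^ 2 ∂μ - ∑ i ∈ Finset.range n, (∫ x, φ i x * h x ∂μ) ^ 2 := by
  rw [integral_sq_sub_sum hφ ho hh]
  simp_rw [← sq]
  ring

theorem sum_sq_integral_mul_le (hφ : ∀ i, BoundedMeasurable (φ i))
    (ho : ∀ i j, ∫ x, φ i x * φ j x ∂μ = if i = j then 1 else 0) {h : α → ℝ}
    (hh : BoundedMeasurable h) (n : ℕ) :
    ∑ i ∈ Finset.range n, (∫ x, φ i x * h x ∂μ) ^ 2 ≤ ∫ x, h x ^ 2 ∂μ := by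
  have h0 : 0 ≤ ∫ x, (h x - ∑ i ∈ Finset.range n, (∫ t, φ i t * h t ∂μ) * φ i x) ^ 2 ∂μ :=
    integral_nonneg fun x => sq_nonneg _
  rw [integral_sq_sub_projection hφ ho hh] at h0
  linarith

/-- Orthogonal projection is the best approximation from the span. Any explicit approximant
therefore bounds the Bessel defect. -/
theorem integral_sq_sub_sum_sq_le (hφ : ∀ i, BoundedMeasurable (φ i))
    (ho : ∀ i j, ∫ x, φ i x * φ j x ∂μ = if i = j then 1 else 0) {h : α → ℝ}
    (hh : BoundedMeasurable h) (n : ℕ) (b : ℕ → ℝ) :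
    ∫ x, h x ^ 2 ∂μ - ∑ i ∈ Finset.range n, (∫ x, φ i x * h x ∂μ) ^ 2
      ≤ ∫ x, (h x - ∑ i ∈ Finset.range n, b i * φ i x) ^ 2 ∂μ := by
  rw [integral_sq_sub_sum hφ ho hh]
  have : ∑ i ∈ Finset.range n, (2 * (b i * ∫ x, φ i x * h x ∂μ))
      ≤ ∑ i ∈ Finset.range n, (b i ^ 2 + (∫ x, φ i x * h x ∂μ) ^ 2) :=
    Finset.sum_le_sum fun i _ => by nlinarith [sq_nonneg (b i - ∫ x, φ i x * h x ∂μ)]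
  rw [← Finset.mul_sum, Finset.sum_add_distrib] at this
  linarith

theorem integral_prod_mul_mul (hφ : ∀ i, BoundedMeasurable (φ i)) {f : α × α → ℝ}
    (hf : BoundedMeasurable f) (i j : ℕ) :
    ∫ z, φ i z.1 * φ j z.2 * f z ∂(μ.prod μ)
      = ∫ y, φ j y * ∫ x, φ i x * f (x, y) ∂μ ∂μ := by
  have hm : BoundedMeasurable fun z : α × α => φ i z.1 * φ j z.2 * f z :=
    (((hφ i).comp measurable_fst).mul ((hφ j).comp measurable_snd)).mul hf
  rw [integral_prod_symm _ (hm.integrable _)]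
  refine integral_congr_ae (Filter.Eventually.of_forall fun y => ?_)
  simp only
  rw [← integral_const_mul]
  congr 1; ext x; ring

/-- The one-variable bound is used twice, first in y on the partial coefficients ∫ φ i(x) f(x, y) dx
and then in x on every slice, so the constant is squared. No orthogonality is needed, which lets the
bound serve monomials as well. -/
theorem sum_sq_integral_prod_le (hφ : ∀ i, BoundedMeasurable (φ i)) {C : ℝ} (hC : 0 ≤ C) {n : ℕ}
    (hB : ∀ h : α → ℝ, BoundedMeasurable h →
      ∑ i ∈ Finset.range n, (∫ x, φ i x * h x ∂μ) ^ 2 ≤ C * ∫ x, h x ^ 2 ∂μ)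
    {f : α × α → ℝ} (hf : BoundedMeasurable f) :
    ∑ i ∈ Finset.range n, ∑ j ∈ Finset.range n, (∫ z, φ i z.1 * φ j z.2 * f z ∂(μ.prod μ)) ^ 2
      ≤ C ^ 2 * ∫ z, f z ^ 2 ∂(μ.prod μ) := by
  have hc : ∀ i, BoundedMeasurable fun y => ∫ x, φ i x * f (x, y) ∂μ := fun i =>
    (((hφ i).comp measurable_fst).mul hf).integral_left μ
  simp_rw [integral_prod_mul_mul hφ hf]
  calc _ ≤ ∑ i ∈ Finset.range n, C * ∫ y, (∫ x, φ i x * f (x, y) ∂μ) ^ 2 ∂μ :=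
        Finset.sum_le_sum fun i _ => hB _ (hc i)
    _ = C * ∫ y, ∑ i ∈ Finset.range n, (∫ x, φ i x * f (x, y) ∂μ) ^ 2 ∂μ := by
        rw [integral_finsetSum _ fun i _ => (hc i).sq.integrable μ, Finset.mul_sum]
    _ ≤ C * ∫ y, C * ∫ x, f (x, y) ^ 2 ∂μ ∂μ := by
        refine mul_le_mul_of_nonneg_left (integral_mono ?_ ?_ fun y => ?_) hC
        · exact (BoundedMeasurable.sum fun i => (hc i).sq).integrable μ
        · exact ((BoundedMeasurable.const _).mul (hf.sq.integral_left μ)).integrable μ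
        · exact hB _ (hf.comp measurable_prodMk_right)
    _ = C ^ 2 * ∫ z, f z ^ 2 ∂(μ.prod μ) := by
        rw [integral_const_mul, integral_prod_symm _ (hf.sq.integrable _)]
        ring

/-- If all slices of `f` are well approximated by the span of `φ 0, …, φ (n - 1)`, then `f` is
well approximated by the span of the products. -/
theorem integral_sq_le_sum_add (hφ : ∀ i, BoundedMeasurable (φ i)) [IsProbabilityMeasure μ]
    (ho : ∀ i j, ∫ x, φ i x * φ j x ∂μ = if i = j then 1 else 0) {n : ℕ} {ε : ℝ}
    {f : α × α → ℝ} (hf : BoundedMeasurable f)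
    (hx : ∀ y, ∫ x, f (x, y) ^ 2 ∂μ
      - ∑ i ∈ Finset.range n, (∫ x, φ i x * f (x, y) ∂μ) ^ 2 ≤ ε)
    (hy : ∀ x, ∫ y, f (x, y) ^ 2 ∂μ
      - ∑ i ∈ Finset.range n, (∫ y, φ i y * f (x, y) ∂μ) ^ 2 ≤ ε) :
    ∫ z, f z ^ 2 ∂(μ.prod μ) ≤ ∑ i ∈ Finset.range n, ∑ j ∈ Finset.range n,
      (∫ z, φ i z.1 * φ j z.2 * f z ∂(μ.prod μ)) ^ 2 + 2 * ε := by
  set c : ℕ → α → ℝ := fun i y => ∫ x, φ i x * f (x, y) ∂μ with hcdef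
  set e : ℕ → α → ℝ := fun j x => ∫ y, φ j y * f (x, y) ∂μ with hedef
  have hc : ∀ i, BoundedMeasurable (c i) := fun i =>
    (((hφ i).comp measurable_fst).mul hf).integral_left μ
  have he : ∀ i, BoundedMeasurable (e i) := fun i =>
    (((hφ i).comp measurable_snd).mul hf).integral_right μ
  have hslice : ∀ y, BoundedMeasurable fun x => f (x, y) := fun y =>
    hf.comp measurable_prodMk_right
  have hslice' : ∀ x, BoundedMeasurable fun y => f (x, y) := fun x =>
    hf.comp measurable_prodMk_left
  have hrows : ∫ z, f z ^ 2 ∂(μ.prod μ) - ∑ i ∈ Finset.range n, ∫ y, c i y ^ 2 ∂μ ≤ ε := by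
    have hsum : BoundedMeasurable fun y => ∑ i ∈ Finset.range n, c i y ^ 2 :=
      .sum fun i => (hc i).sq
    rw [integral_prod_symm _ (hf.sq.integrable _),
      ← integral_finsetSum _ fun i _ => (hc i).sq.integrable μ,
      ← integral_sub ((hf.sq.integral_left μ).integrable μ) (hsum.integrable μ)]
    refine (integral_mono (((hf.sq.integral_left μ).sub hsum).integrable μ)
      (integrable_const ε) hx).trans_eq ?_
    simp
  -- `d` is the residual of `f` after projection in the second variable alone; `hy` bounds its
  -- squared norm by ε.
  set d : α × α → ℝ := fun z => f z - ∑ j ∈ Finset.range n, e j z.1 * φ j z.2 with hddef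
  have hd : BoundedMeasurable d := hf.sub (.sum fun j =>
    ((he j).comp measurable_fst).mul ((hφ j).comp measurable_snd))
  have hresidual : ∫ z, d z ^ 2 ∂(μ.prod μ) ≤ ε := by
    rw [integral_prod _ (hd.sq.integrable _)]
    refine (integral_mono ((hd.sq.integral_right μ).integrable μ) (integrable_const ε)
      fun x => ?_).trans_eq (by simp)
    have := integral_sq_sub_projection hφ ho (hslice' x) n
    exact this.trans_le (hy x)
  have hce : ∀ i j, ∫ x, φ i x * e j x ∂μ = ∫ y, φ j y * c i y ∂μ := fun i j => by
    have hm : BoundedMeasurable fun z : α × α => φ i z.1 * φ j z.2 * f z :=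
      (((hφ i).comp measurable_fst).mul ((hφ j).comp measurable_snd)).mul hf
    rw [← integral_prod_mul_mul hφ hf, integral_prod _ (hm.integrable _)]
    refine integral_congr_ae (Filter.Eventually.of_forall fun x => ?_)
    simp only [hedef]
    rw [← integral_const_mul]
    congr 1; ext y; ring
  -- The projections in the two variables commute: the coefficient of `d` in x is the residual of `c
  -- i` in y. Bessel in x then bounds the total defect of all the `c i` by ‖d‖² ≤ ε, which is
  -- `hcols`.
  have hdi : ∀ i y, ∫ x, φ i x * d (x, y) ∂μ
      = c i y - ∑ j ∈ Finset.range n, (∫ t, φ j t * c i t ∂μ) * φ j y := fun i y => by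
    have m1 : ∀ j, BoundedMeasurable fun x => φ i x * e j x * φ j y := fun j =>
      ((hφ i).mul (he j)).mul (.const _)
    have : ∀ x, φ i x * d (x, y)
        = φ i x * f (x, y) - ∑ j ∈ Finset.range n, φ i x * e j x * φ j y := fun x => by
      simp only [hddef]
      rw [mul_sub, Finset.mul_sum]
      simp_rw [mul_assoc]
    simp_rw [this]
    rw [integral_sub (((hφ i).mul (hslice y)).integrable μ)
      ((BoundedMeasurable.sum m1).integrable μ),
      integral_finsetSum _ fun j _ => (m1 j).integrable μ]
    simp_rw [integral_mul_const, hce]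
    rfl
  have hcols : ∑ i ∈ Finset.range n, (∫ y, c i y ^ 2 ∂μ
      - ∑ j ∈ Finset.range n, (∫ y, φ j y * c i y ∂μ) ^ 2) ≤ ε := by
    have hdm : ∀ i, BoundedMeasurable fun y => ∫ x, φ i x * d (x, y) ∂μ := fun i =>
      (((hφ i).comp measurable_fst).mul hd).integral_left μ
    calc _ = ∫ y, ∑ i ∈ Finset.range n, (∫ x, φ i x * d (x, y) ∂μ) ^ 2 ∂μ := by
          rw [integral_finsetSum _ fun i _ => (hdm i).sq.integrable μ]
          refine Finset.sum_congr rfl fun i _ => ?_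
          rw [← integral_sq_sub_projection hφ ho (hc i)]
          simp_rw [hdi]
      _ ≤ ∫ y, ∫ x, d (x, y) ^ 2 ∂μ ∂μ :=
          integral_mono ((BoundedMeasurable.sum fun i => (hdm i).sq).integrable μ)
            ((hd.sq.integral_left μ).integrable μ)
            fun y => sum_sq_integral_mul_le hφ ho (hd.comp measurable_prodMk_right) n
      _ = ∫ z, d z ^ 2 ∂(μ.prod μ) := (integral_prod_symm _ (hd.sq.integrable _)).symm
      _ ≤ ε := hresidual
  rw [Finset.sum_sub_distrib] at hcols
  simp_rw [integral_prod_mul_mul hφ hf]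
  linarith

end Orthonormal

/-! ### Approximation of intervals by polynomials -/

/-- The Fourier series of the second Bernoulli polynomial, rescaled from [0, 1] to [0, 2π]. -/
theorem hasSum_cos_div_sq {t : ℝ} (h0 : 0 ≤ t) (h1 : t ≤ 2 * Real.pi) :
    HasSum (fun n : ℕ => 1 / (n : ℝ) ^ 2 * Real.cos (n * t))
      (t ^ 2 / 4 - Real.pi * t / 2 + Real.pi ^ 2 / 6) := by
  have hpi := Real.pi_pos
  have h := hasSum_one_div_nat_pow_mul_cos (k := 1) one_ne_zero (x := t / (2 * Real.pi))
    ⟨by positivity, (div_le_one (by positivity)).2 h1⟩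
  convert h using 1
  · ext n
    congr 2
    field_simp
  · norm_num [Polynomial.bernoulli_def, Finset.sum_range_succ, bernoulli_two, bernoulli_one, Nat.choose]
    field_simp
    ring

/-- Up to normalization and the constant term, this is Parseval's identity for the indicator of [a,
b] in the cosine basis of [0, π]. Instead of invoking completeness, the square is expanded into
cosines and the series above is evaluated at 0, 2b, 2a, b - a and b + a. -/
theorem hasSum_sq_sin_sub_sin_div {a b : ℝ} (ha : 0 ≤ a) (hab : a ≤ b) (hb : b ≤ Real.pi) :
    HasSum (fun n : ℕ => ((Real.sin (n * b) - Real.sin (n * a)) / n) ^ 2)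
      (Real.pi * (b - a) / 2 - (b - a) ^ 2 / 2) := by
  have h0 := hasSum_cos_div_sq (t := 0) le_rfl (by positivity)
  have h1 := hasSum_cos_div_sq (t := 2 * b) (by linarith) (by linarith)
  have h2 := hasSum_cos_div_sq (t := 2 * a) (by linarith) (by linarith)
  have h3 := hasSum_cos_div_sq (t := b - a) (by linarith) (by linarith)
  have h4 := hasSum_cos_div_sq (t := b + a) (by linarith) (by linarith)
  have H := (((h0.sub (h1.mul_left (1 / 2))).sub (h2.mul_left (1 / 2))).sub h3).add h4
  have hfun : ∀ n : ℕ, ((Real.sin (n * b) - Real.sin (n * a)) / n) ^ 2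
      = 1 / (n : ℝ) ^ 2 * Real.cos (n * 0) - 1 / 2 * (1 / (n : ℝ) ^ 2 * Real.cos (n * (2 * b)))
        - 1 / 2 * (1 / (n : ℝ) ^ 2 * Real.cos (n * (2 * a)))
        - 1 / (n : ℝ) ^ 2 * Real.cos (n * (b - a))
        + 1 / (n : ℝ) ^ 2 * Real.cos (n * (b + a)) := fun n => by
    rw [mul_zero, Real.cos_zero, show (n : ℝ) * (2 * b) = 2 * (n * b) by ring,
      show (n : ℝ) * (2 * a) = 2 * (n * a) by ring, mul_sub, mul_add, Real.cos_sub, Real.cos_add,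
      Real.cos_two_mul', Real.cos_two_mul']
    have e1 := Real.sin_sq_add_cos_sq (n * b)
    have e2 := Real.sin_sq_add_cos_sq (n * a)
    rw [div_pow, ← one_div_mul_eq_div]
    linear_combination (1 / (n : ℝ) ^ 2) * (e1 + e2) / 2
  simp_rw [hfun]
  refine (congrArg (HasSum _) ?_).mpr H
  ring

theorem integral_cos_int_mul (m : ℤ) :
    ∫ t in (0 : ℝ)..Real.pi, Real.cos (m * t) = if m = 0 then Real.pi else 0 := by
  split_ifs with h
  · simp [h]
  · have hm : (m : ℝ) ≠ 0 := by exact_mod_cast h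
    rw [intervalIntegral.integral_comp_mul_left (fun t => Real.cos t) hm, integral_cos]
    simp [Real.sin_int_mul_pi]

/-- The orthonormal cosines on `[0, π]`. -/
noncomputable def normedCos (k : ℕ) (t : ℝ) : ℝ :=
  (if k = 0 then √(1 / Real.pi) else √(2 / Real.pi)) * Real.cos (k * t)

theorem boundedMeasurable_normedCos (k : ℕ) : BoundedMeasurable (normedCos k) :=
  (BoundedMeasurable.const _).mul
    ⟨(by fun_prop : Continuous fun t : ℝ => Real.cos (k * t)).measurable, 1,
      fun _ => Real.abs_cos_le_one _⟩

theorem integral_normedCos_mul_normedCos (i j : ℕ) :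
    ∫ t in Set.Icc 0 Real.pi, normedCos i t * normedCos j t = if i = j then 1 else 0 := by
  have hpi := Real.pi_pos
  rw [integral_Icc_eq_integral_Ioc, ← intervalIntegral.integral_of_le hpi.le]
  have e : ∀ t, normedCos i t * normedCos j t =
      (if i = 0 then √(1 / Real.pi) else √(2 / Real.pi)) *
      (if j = 0 then √(1 / Real.pi) else √(2 / Real.pi)) / 2 *
      (Real.cos (((i : ℤ) - j : ℤ) * t) + Real.cos (((i : ℤ) + j : ℤ) * t)) := fun t => by
    simp only [normedCos]
    push_cast
    rw [sub_mul, add_mul, Real.cos_sub, Real.cos_add]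
    ring
  simp_rw [e]
  rw [intervalIntegral.integral_const_mul, intervalIntegral.integral_add
    ((by fun_prop : Continuous fun t : ℝ => Real.cos (((i : ℤ) - j : ℤ) * t)).intervalIntegrable _ _)
    ((by fun_prop : Continuous fun t : ℝ => Real.cos (((i : ℤ) + j : ℤ) * t)).intervalIntegrable _ _),
    integral_cos_int_mul, integral_cos_int_mul]
  by_cases hij : i = j
  · subst hij
    by_cases hi : i = 0
    · subst hi
      simp only [if_true, Nat.cast_zero, sub_zero, add_zero]
      rw [Real.mul_self_sqrt (by positivity)]
      field_simp
      norm_num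
    · rw [if_neg hi, if_pos (by ring), if_neg (by omega), if_pos rfl, Real.mul_self_sqrt (by positivity)]
      field_simp
      norm_num
  · rw [if_neg (by omega : ¬ ((i : ℤ) - j = 0)), if_neg (by omega : ¬ ((i : ℤ) + j = 0)), if_neg hij]
    simp

/-- Truncate the cosine series of the indicator: by the Parseval identity above, the squared error
is 2/π times the tail of ((sin nb - sin na)/n)² ≤ 4/n². The tail beyond N is at most 8/(N+1), and
16/π ≤ 6. -/
theorem exists_cos_sum_approx {a b : ℝ} (ha : 0 ≤ a) (hab : a ≤ b) (hb : b ≤ Real.pi) (N : ℕ) :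
    ∃ c : ℕ → ℝ, ∫ t in Set.Icc 0 Real.pi, ((Set.Icc a b).indicator (1 : ℝ → ℝ) t
      - ∑ k ∈ Finset.range (N + 1), c k * Real.cos (k * t)) ^ 2 ≤ 6 / (N + 1) := by
  have hpi := Real.pi_pos
  set h : ℝ → ℝ := (Set.Icc a b).indicator (1 : ℝ → ℝ) with hh
  have hbm : BoundedMeasurable h := ⟨measurable_one.indicator measurableSet_Icc, 1, fun t => by
    by_cases ht : t ∈ Set.Icc a b <;> simp [hh, ht]⟩
  have key := integral_sq_sub_projection (μ := volume.restrict (Set.Icc 0 Real.pi))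
    boundedMeasurable_normedCos integral_normedCos_mul_normedCos hbm (N + 1)
  have hsub : Set.Icc a b ⊆ Set.Icc 0 Real.pi := Set.Icc_subset_Icc ha hb
  have hind : ∀ F : ℝ → ℝ, ∫ t in Set.Icc 0 Real.pi, F t * h t = ∫ t in a..b, F t := fun F => by
    have : (fun t => F t * h t) = (Set.Icc a b).indicator F := by
      ext t; by_cases ht : t ∈ Set.Icc a b <;> simp [hh, ht]
    rw [this, integral_indicator measurableSet_Icc, Measure.restrict_restrict measurableSet_Icc,
      Set.inter_eq_left.2 hsub, integral_Icc_eq_integral_Ioc, intervalIntegral.integral_of_le hab]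
  have hsq : ∫ t in Set.Icc 0 Real.pi, h t ^ 2 = b - a := by
    simp_rw [sq]
    rw [hind, intervalIntegral.integral_congr (g := fun _ => (1 : ℝ))]
    · simp
    · intro t ht
      rw [Set.uIcc_of_le hab] at ht
      simp [hh, ht]
  have hcoef : ∀ k : ℕ, (∫ t in Set.Icc 0 Real.pi, normedCos (k + 1) t * h t) ^ 2
      = 2 / Real.pi *
        ((Real.sin ((k + 1 : ℕ) * b) - Real.sin ((k + 1 : ℕ) * a)) / (k + 1 : ℕ)) ^ 2 := fun k => by
    rw [hind]
    simp only [normedCos, Nat.succ_ne_zero, if_false]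
    rw [intervalIntegral.integral_const_mul, intervalIntegral.integral_comp_mul_left
      (fun t => Real.cos t) (by positivity : ((k + 1 : ℕ) : ℝ) ≠ 0), integral_cos, mul_pow,
      Real.sq_sqrt (by positivity), smul_eq_mul, inv_mul_eq_div]
  have hcoef0 : (∫ t in Set.Icc 0 Real.pi, normedCos 0 t * h t) ^ 2 = (b - a) ^ 2 / Real.pi := by
    rw [hind]
    simp only [normedCos, if_true, Nat.cast_zero, zero_mul, Real.cos_zero, mul_one]
    rw [intervalIntegral.integral_const, smul_eq_mul, mul_pow, Real.sq_sqrt (by positivity)]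
    ring
  set A : ℕ → ℝ := fun n => ((Real.sin (n * b) - Real.sin (n * a)) / n) ^ 2 with hA
  have hA0 : A 0 = 0 := by simp [hA]
  have hAle : ∀ n, A n ≤ 4 * ((n : ℝ) ^ 2)⁻¹ := fun n => by
    simp only [hA]
    rw [div_pow, div_eq_mul_inv]
    refine mul_le_mul_of_nonneg_right ?_ (by positivity)
    have h1 := Real.abs_sin_le_one (n * b)
    have h2 := Real.abs_sin_le_one (n * a)
    have h3 : |Real.sin (n * b) - Real.sin (n * a)| ≤ 2 := (abs_sub _ _).trans (by linarith)
    calc _ = |Real.sin (n * b) - Real.sin (n * a)| ^ 2 := (sq_abs _).symm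
      _ ≤ 2 ^ 2 := by gcongr
      _ = 4 := by norm_num
  have htail : Real.pi * (b - a) / 2 - (b - a) ^ 2 / 2
      ≤ ∑ n ∈ Finset.range (N + 1), A n + 8 / (N + 1) := by
    refine hasSum_le_of_sum_le (hasSum_sq_sin_sub_sin_div ha hab hb) fun s => ?_
    obtain ⟨M, hM⟩ := s.exists_nat_subset_range
    have hAn : ∀ n, 0 ≤ A n := fun n => sq_nonneg _
    calc ∑ n ∈ s, A n ≤ ∑ n ∈ Finset.range (N + 1) ∪ Finset.Ioo N M, A n := by
          refine Finset.sum_le_sum_of_subset_of_nonneg (fun n hn => ?_) fun n _ _ => hAn n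
          have := Finset.mem_range.1 (hM hn)
          simp only [Finset.mem_union, Finset.mem_range, Finset.mem_Ioo]
          omega
      _ ≤ ∑ n ∈ Finset.range (N + 1), A n + ∑ n ∈ Finset.Ioo N M, A n := by
          rw [Finset.sum_union (Finset.disjoint_left.2 fun n h1 h2 => by
            simp only [Finset.mem_range, Finset.mem_Ioo] at h1 h2; omega)]
      _ ≤ ∑ n ∈ Finset.range (N + 1), A n + 8 / (N + 1) := by
          have h1 := Finset.sum_le_sum fun n (_ : n ∈ Finset.Ioo N M) => hAle n
          rw [← Finset.mul_sum] at h1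
          have h2 := sum_Ioo_inv_sq_le (α := ℝ) N M
          have h3 : (8 : ℝ) / (N + 1) = 4 * (2 / (N + 1)) := by ring
          rw [h3]
          linarith
  refine ⟨fun k => (∫ t in Set.Icc 0 Real.pi, normedCos k t * h t) *
    (if k = 0 then √(1 / Real.pi) else √(2 / Real.pi)), ?_⟩
  have heq : ∀ t, ∑ k ∈ Finset.range (N + 1), (∫ t in Set.Icc 0 Real.pi, normedCos k t * h t) *
      (if k = 0 then √(1 / Real.pi) else √(2 / Real.pi)) * Real.cos (k * t)
      = ∑ k ∈ Finset.range (N + 1), (∫ t in Set.Icc 0 Real.pi, normedCos k t * h t) *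
        normedCos k t := fun t => Finset.sum_congr rfl fun k _ => by
    rw [normedCos, mul_assoc]
  simp_rw [heq]
  rw [key, hsq, Finset.sum_range_succ', hcoef0]
  simp_rw [hcoef]
  rw [← Finset.mul_sum]
  rw [Finset.sum_range_succ', hA0, add_zero] at htail
  have hfin : b - a - (2 / Real.pi * ∑ k ∈ Finset.range N, A (k + 1) + (b - a) ^ 2 / Real.pi)
      = 2 / Real.pi * (Real.pi * (b - a) / 2 - (b - a) ^ 2 / 2
        - ∑ k ∈ Finset.range N, A (k + 1)) := by
    field_simp
    ring
  refine hfin.trans_le ?_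
  calc _ ≤ 2 / Real.pi * (8 / (N + 1)) := mul_le_mul_of_nonneg_left (by linarith) (by positivity)
    _ ≤ 6 / (N + 1) := by
        rw [div_mul_div_comm, div_le_div_iff₀ (by positivity) (by positivity)]
        have := Real.pi_gt_three
        have hN : (0 : ℝ) < N + 1 := by positivity
        nlinarith

/-- The substitution `x = c - r cos t`. -/
theorem integral_Icc_eq_integral_cos (F : ℝ → ℝ) (c : ℝ) {r : ℝ} (hr : 0 < r) :
    ∫ x in Set.Icc (c - r) (c + r), F x
      = ∫ t in Set.Icc 0 Real.pi, r * Real.sin t * F (c - r * Real.cos t) := by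
  have hpi := Real.pi_pos
  have hcont : Continuous fun t : ℝ => c - r * Real.cos t := by fun_prop
  have hmono : StrictMonoOn (fun t : ℝ => c - r * Real.cos t) (Set.Icc 0 Real.pi) :=
    fun s hs t ht hst => by
      have := Real.strictAntiOn_cos hs ht hst
      simp only
      nlinarith
  have himg : (fun t : ℝ => c - r * Real.cos t) '' Set.Icc 0 Real.pi = Set.Icc (c - r) (c + r) := by
    rw [hcont.continuousOn.image_Icc_of_monotoneOn hpi.le hmono.monotoneOn]
    simp
  rw [← himg, integral_image_eq_integral_abs_deriv_smul measurableSet_Icc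
    (f' := fun t => r * Real.sin t) (fun t _ => ?_) hmono.injOn]
  · refine setIntegral_congr_fun measurableSet_Icc fun t ht => ?_
    simp only [smul_eq_mul]
    rw [abs_of_nonneg (mul_nonneg hr.le (Real.sin_nonneg_of_mem_Icc ht))]
  · have := ((Real.hasDerivAt_cos t).const_mul r).const_sub c
    simpa using this.hasDerivWithinAt

/-- Under x = (1 - cos t)/2 the functions cos kt become Chebyshev polynomials in 1 - 2x. The
preimage of an interval is an interval by monotonicity, and the Jacobian sin(t)/2 ≤ 1/2 halves the
constant 6. -/
theorem exists_polynomial_approx {I : Set ℝ} (hI : IsCompact I) (hI' : I.OrdConnected) (N : ℕ) :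
    ∃ p : Polynomial ℝ, p.natDegree ≤ N ∧
      ∫ x, (I.indicator (1 : ℝ → ℝ) x - p.eval x) ^ 2 ∂unitVolume ≤ 3 / (N + 1) := by
  have hpi := Real.pi_pos
  set u : ℝ → ℝ := fun t => 1 / 2 - 1 / 2 * Real.cos t with hu
  have hucont : Continuous u := by fun_prop
  set J : Set ℝ := Set.Icc 0 Real.pi ∩ u ⁻¹' I with hJ
  have hJc : IsCompact J := isCompact_Icc.inter_right (hI.isClosed.preimage hucont)
  have humono : MonotoneOn u (Set.Icc 0 Real.pi) := fun s hs t ht hst => by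
    have := Real.strictAntiOn_cos.antitoneOn hs ht hst
    simp only [hu]
    linarith
  have hJo : J.OrdConnected := ⟨fun s hs t ht w hw => by
    have hw' : w ∈ Set.Icc 0 Real.pi := ⟨hs.1.1.trans hw.1, hw.2.trans ht.1.2⟩
    exact ⟨hw', hI'.out hs.2 ht.2 ⟨humono hs.1 hw' hw.1, humono hw' ht.1 hw.2⟩⟩⟩
  obtain ⟨c, hc⟩ : ∃ c : ℕ → ℝ, ∫ t in Set.Icc 0 Real.pi, (J.indicator (1 : ℝ → ℝ) t
      - ∑ k ∈ Finset.range (N + 1), c k * Real.cos (k * t)) ^ 2 ≤ 6 / (N + 1) := by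
    rcases J.eq_empty_or_nonempty with hJe | hJn
    · refine ⟨0, ?_⟩
      simp only [hJe, Set.indicator_empty, Pi.zero_apply, zero_mul, Finset.sum_const_zero, sub_zero]
      norm_num
      positivity
    · have hJi : J = Set.Icc (sInf J) (sSup J) :=
        eq_Icc_of_connected_compact ⟨hJn, hJo.isPreconnected⟩ hJc
      have h1 := hJc.sInf_mem hJn
      have h2 := hJc.sSup_mem hJn
      rw [hJi]
      exact exists_cos_sum_approx h1.1.1 (csInf_le_csSup hJn hJc.bddBelow hJc.bddAbove) h2.1.2 N
  refine ⟨∑ k ∈ Finset.range (N + 1), Polynomial.C (c k) *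
    (Polynomial.Chebyshev.T ℝ k).comp (1 - 2 * Polynomial.X), ?_, ?_⟩
  · refine Polynomial.natDegree_sum_le_of_forall_le _ _ fun k hk => ?_
    refine (Polynomial.natDegree_C_mul_le _ _).trans ?_
    rw [Polynomial.natDegree_comp]
    have h1 : (1 - 2 * Polynomial.X : Polynomial ℝ).natDegree ≤ 1 := by compute_degree
    have h2 : (Polynomial.Chebyshev.T ℝ k).natDegree ≤ k := by simp
    have := Finset.mem_range.1 hk
    nlinarith
  · have hset : Set.Icc (0 : ℝ) 1 = Set.Icc (1 / 2 - 1 / 2) (1 / 2 + 1 / 2) := by norm_num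
    rw [unitVolume, hset, integral_Icc_eq_integral_cos _ _ (by norm_num : (0 : ℝ) < 1 / 2)]
    set G : ℝ → ℝ := fun t => J.indicator (1 : ℝ → ℝ) t
      - ∑ k ∈ Finset.range (N + 1), c k * Real.cos (k * t) with hG
    have hGint : IntegrableOn (fun t => G t ^ 2) (Set.Icc 0 Real.pi) := by
      have h1 : BoundedMeasurable G := BoundedMeasurable.sub
        ⟨measurable_one.indicator hJc.measurableSet, 1, fun t => by
          by_cases ht : t ∈ J <;> simp [ht]⟩
        (.sum fun k => (BoundedMeasurable.const _).mul
          ⟨(by fun_prop : Continuous fun t : ℝ => Real.cos (k * t)).measurable, 1,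
            fun _ => Real.abs_cos_le_one _⟩)
      exact h1.sq.integrable _
    have hle : ∀ t ∈ Set.Icc 0 Real.pi, 1 / 2 * Real.sin t *
        (I.indicator (1 : ℝ → ℝ) (1 / 2 - 1 / 2 * Real.cos t) - (∑ k ∈ Finset.range (N + 1),
          Polynomial.C (c k) * (Polynomial.Chebyshev.T ℝ k).comp (1 - 2 * Polynomial.X)).eval
            (1 / 2 - 1 / 2 * Real.cos t)) ^ 2 = 1 / 2 * Real.sin t * G t ^ 2 := fun t ht => by
      have e1 : I.indicator (1 : ℝ → ℝ) (1 / 2 - 1 / 2 * Real.cos t)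
          = J.indicator (1 : ℝ → ℝ) t := by
        by_cases htI : u t ∈ I
        · rw [Set.indicator_of_mem htI, Set.indicator_of_mem (show t ∈ J from ⟨ht, htI⟩)]; rfl
        · rw [Set.indicator_of_notMem htI, Set.indicator_of_notMem fun h => htI h.2]
      have e2 : (1 : ℝ) - 2 * (1 / 2 - 1 / 2 * Real.cos t) = Real.cos t := by ring
      rw [e1, hG, Polynomial.eval_finsetSum]
      simp only [Polynomial.eval_mul, Polynomial.eval_C, Polynomial.eval_comp, Polynomial.eval_sub,
        Polynomial.eval_one, Polynomial.eval_ofNat, Polynomial.eval_X, e2,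
        Polynomial.Chebyshev.T_real_cos, Int.cast_natCast]
    rw [setIntegral_congr_fun measurableSet_Icc hle]
    calc _ ≤ ∫ t in Set.Icc 0 Real.pi, (1 / 2 : ℝ) * G t ^ 2 := by
          refine integral_mono_of_nonneg ?_ (hGint.const_mul _) ?_
          · exact (ae_restrict_iff' measurableSet_Icc).2 (Filter.Eventually.of_forall fun t ht => by
              have := Real.sin_nonneg_of_mem_Icc ht
              simp only [Pi.zero_apply]
              positivity)
          · refine Filter.Eventually.of_forall fun t => ?_
            simp only
            have := Real.sin_le_one t
            nlinarith [sq_nonneg (G t)]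
      _ ≤ (3 : ℝ) / (N + 1) := by
          rw [integral_const_mul]
          have : (3 : ℝ) / (N + 1) = 1 / 2 * (6 / (N + 1)) := by ring
          rw [this]
          linarith

/-! ### Inscribed polygons -/

/-- The length of the vertical section of a planar set. -/
noncomputable def sectionLength (K : Set (ℝ × ℝ)) (x : ℝ) : ℝ := volume.real (Prod.mk x ⁻¹' K)

theorem sectionLength_nonneg (K : Set (ℝ × ℝ)) (x : ℝ) : 0 ≤ sectionLength K x := measureReal_nonneg

theorem isCompact_section {K : Set (ℝ × ℝ)} (hK : IsCompact K) (x : ℝ) :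
    IsCompact (Prod.mk x ⁻¹' K) :=
  (hK.image continuous_snd).of_isClosed_subset
    (hK.isClosed.preimage (by fun_prop)) fun y hy => ⟨(x, y), hy, rfl⟩

theorem convex_preimage_mk_left {K : Set (ℝ × ℝ)} (hK : Convex ℝ K) (x : ℝ) :
    Convex ℝ (Prod.mk x ⁻¹' K) := fun a ha b hb s t hs ht hst => by
  have := hK ha hb hs ht hst
  simpa [← add_mul, hst] using this

theorem integrable_indicator_one {K : Set (ℝ × ℝ)} (hK : IsCompact K) :
    Integrable (K.indicator (1 : ℝ × ℝ → ℝ)) :=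
  (integrable_indicator_iff hK.measurableSet).2 (integrableOn_const hK.measure_lt_top.ne)

theorem integral_indicator_section {K : Set (ℝ × ℝ)} (hK : IsCompact K) (x : ℝ) :
    ∫ y, K.indicator (1 : ℝ × ℝ → ℝ) (x, y) = sectionLength K x := by
  have : (fun y => K.indicator (1 : ℝ × ℝ → ℝ) (x, y)) = (Prod.mk x ⁻¹' K).indicator 1 := by
    ext y; by_cases hy : (x, y) ∈ K <;> simp [hy]
  rw [this, integral_indicator_one (isCompact_section hK x).measurableSet, sectionLength]

theorem integrable_sectionLength {K : Set (ℝ × ℝ)} (hK : IsCompact K) :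
    Integrable (sectionLength K) := by
  have h := (integrable_indicator_one hK).integral_prod_left
  simpa only [integral_indicator_section hK] using h

theorem integral_sectionLength {K : Set (ℝ × ℝ)} (hK : IsCompact K) :
    ∫ x, sectionLength K x = volume.real K := by
  rw [← integral_indicator_one hK.measurableSet, Measure.volume_eq_prod,
    integral_prod _ (integrable_indicator_one hK)]
  simp_rw [integral_indicator_section hK]

theorem exists_section_endpoints {K : Set (ℝ × ℝ)} (hK : IsCompact K) (hK' : Convex ℝ K) {x : ℝ}
    (hx : x ∈ Prod.fst '' K) :
    ∃ g f : ℝ, g ≤ f ∧ (x, g) ∈ K ∧ (x, f) ∈ K ∧ f - g = sectionLength K x := by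
  have hc := isCompact_section hK x
  have hn : (Prod.mk x ⁻¹' K).Nonempty := by
    obtain ⟨⟨a, b⟩, hab, rfl⟩ := hx
    exact ⟨b, hab⟩
  have hconv := convex_preimage_mk_left hK' x
  have hI := eq_Icc_of_connected_compact ⟨hn, hconv.ordConnected.isPreconnected⟩ hc
  have hle := csInf_le_csSup hn hc.bddBelow hc.bddAbove
  refine ⟨_, _, hle, hc.sInf_mem hn, hc.sSup_mem hn, ?_⟩
  rw [sectionLength]
  nth_rewrite 3 [hI]
  rw [Real.volume_real_Icc_of_le hle]

/-- By convexity the section at an intermediate abscissa contains the segment between the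
interpolated endpoints, so its length dominates the linear interpolation of the two given lengths.
-/
theorem trapezoid_le_integral_sectionLength {Q : Set (ℝ × ℝ)} (hQ : IsCompact Q)
    (hQ' : Convex ℝ Q) {x₀ x₁ g₀ f₀ g₁ f₁ : ℝ} (hx : x₀ ≤ x₁) (h₀ : g₀ ≤ f₀) (h₁ : g₁ ≤ f₁)
    (hg₀ : (x₀, g₀) ∈ Q) (hf₀ : (x₀, f₀) ∈ Q) (hg₁ : (x₁, g₁) ∈ Q) (hf₁ : (x₁, f₁) ∈ Q) :
    (x₁ - x₀) * ((f₀ - g₀) + (f₁ - g₁)) / 2 ≤ ∫ x in x₀..x₁, sectionLength Q x := by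
  rcases hx.eq_or_lt with rfl | hlt
  · simp
  have hw : 0 < x₁ - x₀ := sub_pos.2 hlt
  set k := ((f₁ - g₁) - (f₀ - g₀)) / (x₁ - x₀) with hk
  have hlin : ∫ x in x₀..x₁, ((f₀ - g₀ - k * x₀) + k * x)
      = (x₁ - x₀) * ((f₀ - g₀) + (f₁ - g₁)) / 2 := by
    rw [intervalIntegral.integral_add (by simp) ((by fun_prop :
      Continuous fun x : ℝ => k * x).intervalIntegrable _ _), intervalIntegral.integral_const,
      intervalIntegral.integral_const_mul, integral_id, smul_eq_mul]
    have hk' : k * (x₁ - x₀) = (f₁ - g₁) - (f₀ - g₀) := div_mul_cancel₀ _ hw.ne'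
    linear_combination (x₁ - x₀) / 2 * hk'
  rw [← hlin]
  refine intervalIntegral.integral_mono_on hx ((by fun_prop :
    Continuous fun x : ℝ => (f₀ - g₀ - k * x₀) + k * x).intervalIntegrable _ _)
    (integrable_sectionLength hQ).intervalIntegrable fun x hxx => ?_
  set l := (x - x₀) / (x₁ - x₀) with hl
  have hl0 : 0 ≤ l := div_nonneg (sub_nonneg.2 hxx.1) hw.le
  have hl1 : l ≤ 1 := (div_le_one hw).2 (by linarith [hxx.2])
  have hlx : l * (x₁ - x₀) = x - x₀ := div_mul_cancel₀ _ hw.ne'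
  have hkl : k * (x - x₀) = l * ((f₁ - g₁) - (f₀ - g₀)) := by rw [hk, hl]; ring
  have hmem : ∀ y₀ y₁, (x₀, y₀) ∈ Q → (x₁, y₁) ∈ Q → (1 - l) * y₀ + l * y₁ ∈ Prod.mk x ⁻¹' Q :=
    fun y₀ y₁ hy₀ hy₁ => by
      have := hQ' hy₀ hy₁ (sub_nonneg.2 hl1) hl0 (by ring)
      have e : (1 - l) • (x₀, y₀) + l • (x₁, y₁) = (x, (1 - l) * y₀ + l * y₁) := by
        ext
        · simp only [Prod.fst_add, Prod.smul_fst, smul_eq_mul]; linarith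
        · simp
      rwa [e] at this
  have hsub : Set.Icc ((1 - l) * g₀ + l * g₁) ((1 - l) * f₀ + l * f₁) ⊆ Prod.mk x ⁻¹' Q := by
    exact (convex_preimage_mk_left hQ' x).ordConnected.out (hmem _ _ hg₀ hg₁) (hmem _ _ hf₀ hf₁)
  have hle : (1 - l) * g₀ + l * g₁ ≤ (1 - l) * f₀ + l * f₁ :=
    add_le_add (mul_le_mul_of_nonneg_left h₀ (sub_nonneg.2 hl1)) (mul_le_mul_of_nonneg_left h₁ hl0)
  have := measureReal_mono hsub ((isCompact_section hQ x).measure_lt_top (μ := volume)).ne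
  rw [Real.volume_real_Icc_of_le hle] at this
  rw [sectionLength]
  linarith

theorem sum_trapezoid_le_volume {Q : Set (ℝ × ℝ)} (hQ : IsCompact Q) (hQ' : Convex ℝ Q)
    {x g f : ℕ → ℝ} {m : ℕ} (hx : ∀ i < m, x i ≤ x (i + 1)) (hgf : ∀ i ≤ m, g i ≤ f i)
    (hg : ∀ i ≤ m, (x i, g i) ∈ Q) (hf : ∀ i ≤ m, (x i, f i) ∈ Q) :
    ∑ i ∈ Finset.range m, (x (i + 1) - x i) * ((f i - g i) + (f (i + 1) - g (i + 1))) / 2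
      ≤ volume.real Q := by
  have hint := integrable_sectionLength hQ
  have hmono : x 0 ≤ x m := by
    have : ∀ j ≤ m, x 0 ≤ x j := fun j => by
      induction j with
      | zero => simp
      | succ j ih => exact fun hj => (ih (by omega)).trans (hx j (by omega))
    exact this m le_rfl
  calc _ ≤ ∑ i ∈ Finset.range m, ∫ t in (x i)..(x (i + 1)), sectionLength Q t :=
        Finset.sum_le_sum fun i hi => by
          have hi' := Finset.mem_range.1 hi
          exact trapezoid_le_integral_sectionLength hQ hQ' (hx i hi') (hgf _ hi'.le) (hgf _ hi')
            (hg _ hi'.le) (hf _ hi'.le) (hg _ hi') (hf _ hi')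
    _ = ∫ t in (x 0)..(x m), sectionLength Q t :=
        intervalIntegral.sum_integral_adjacent_intervals fun i _ => hint.intervalIntegrable
    _ ≤ ∫ t, sectionLength Q t := by
        rw [intervalIntegral.integral_of_le hmono]
        exact setIntegral_le_integral hint
          (Filter.Eventually.of_forall fun t => sectionLength_nonneg Q t)
    _ = volume.real Q := integral_sectionLength hQ

/-- The average of the inscribed trapezoid sums over all shifts of the nodes. -/
theorem le_integral_sum_trapezoid {G : ℝ → ℝ} (hG : BoundedMeasurable G) (hG0 : ∀ t, 0 ≤ G t)
    (hG1 : ∀ t, G t ≤ 1) {h : ℝ} (hh : 0 < h) {m : ℕ} (hm : m * h = Real.pi - h) :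
    2 * Real.sin h * (∫ t in (0 : ℝ)..Real.pi, Real.sin t * G t) - h ^ 3
      ≤ ∫ s in (0 : ℝ)..h, ∑ i ∈ Finset.range m, (Real.cos (s + i * h) - Real.cos (s + (i + 1) * h)) *
          (G (s + i * h) + G (s + (i + 1) * h)) := by
  have hpi := Real.pi_pos
  have hhpi : 0 ≤ Real.pi - h := by rw [← hm]; positivity
  have hcos : ∀ c : ℝ, BoundedMeasurable fun t => Real.cos (t + c) := fun c =>
    ⟨(by fun_prop : Continuous fun t : ℝ => Real.cos (t + c)).measurable, 1,
      fun _ => Real.abs_cos_le_one _⟩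
  have hGc : ∀ c : ℝ, BoundedMeasurable fun t => G (t + c) := fun c =>
    hG.comp (measurable_add_const c)
  have hint : ∀ {F : ℝ → ℝ}, BoundedMeasurable F → ∀ a b : ℝ, IntervalIntegrable F volume a b :=
    fun hF a b => ⟨hF.integrable _, hF.integrable _⟩
  set D : ℝ → ℝ := fun t => (Real.cos (t + 0) - Real.cos (t + h)) * (G (t + 0) + G (t + h)) with hD
  have hDm : BoundedMeasurable D := ((hcos 0).sub (hcos h)).mul ((hGc 0).add (hGc h))
  -- As `s` runs over [0, h], the points s + ih tile [0, mh] = [0, π - h], so the average over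
  -- shifts becomes one integral of `D`.
  have hsum : ∫ s in (0 : ℝ)..h, ∑ i ∈ Finset.range m,
      (Real.cos (s + i * h) - Real.cos (s + (i + 1) * h)) *
          (G (s + i * h) + G (s + (i + 1) * h)) = ∫ t in (0 : ℝ)..(Real.pi - h), D t := by
    have e : ∀ s : ℝ, ∀ i : ℕ, (Real.cos (s + i * h) - Real.cos (s + (i + 1) * h)) *
          (G (s + i * h) + G (s + (i + 1) * h)) = D (s + i * h) := fun s i => by
      simp only [hD, add_zero]
      rw [show s + i * h + h = s + (i + 1) * h by ring]
    simp_rw [e]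
    rw [intervalIntegral.integral_finsetSum fun i _ =>
      hint (hDm.comp (measurable_add_const _)) _ _]
    simp_rw [intervalIntegral.integral_comp_add_right]
    have := intervalIntegral.sum_integral_adjacent_intervals (μ := volume) (f := D)
      (a := fun i : ℕ => (i : ℝ) * h) (n := m) fun i _ => hint hDm _ _
    simp only [Nat.cast_zero, zero_mul, hm] at this
    rw [← this]
    refine Finset.sum_congr rfl fun i _ => ?_
    push_cast
    congr 1 <;> ring
  have ha : BoundedMeasurable fun t => (Real.cos (t + 0) - Real.cos (t + h)) * G t :=
    ((hcos 0).sub (hcos h)).mul hG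
  have hb : BoundedMeasurable fun t => (Real.cos (t + -h) - Real.cos (t + 0)) * G t :=
    ((hcos (-h)).sub (hcos 0)).mul hG
  have hb' : BoundedMeasurable fun t => (Real.cos (t + 0) - Real.cos (t + h)) * G (t + h) :=
    ((hcos 0).sub (hcos h)).mul (hGc h)
  have hsplit : ∫ t in (0 : ℝ)..(Real.pi - h), D t
      = (∫ t in (0 : ℝ)..(Real.pi - h), (Real.cos (t + 0) - Real.cos (t + h)) * G t)
        + ∫ t in h..Real.pi, (Real.cos (t + -h) - Real.cos (t + 0)) * G t := by
    have e1 : ∀ t, D t = (Real.cos (t + 0) - Real.cos (t + h)) * G t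
        + (Real.cos (t + 0) - Real.cos (t + h)) * G (t + h) := fun t => by
      simp only [hD, add_zero]; ring
    have e2 : ∀ t, (Real.cos (t + 0) - Real.cos (t + h)) * G (t + h)
        = (fun t => (Real.cos (t + -h) - Real.cos (t + 0)) * G t) (t + h) := fun t => by
      simp
    simp_rw [e1]
    rw [intervalIntegral.integral_add (hint ha _ _) (hint hb' _ _)]
    congr 1
    simp_rw [e2]
    rw [intervalIntegral.integral_comp_add_right
      (fun t => (Real.cos (t + -h) - Real.cos (t + 0)) * G t)]
    congr 1 <;> ring
  have hA := intervalIntegral.integral_add_adjacent_intervals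
    (hint ha 0 (Real.pi - h)) (hint ha (Real.pi - h) Real.pi)
  have hB := intervalIntegral.integral_add_adjacent_intervals (hint hb 0 h) (hint hb h Real.pi)
  -- Over the full range the two halves add up through cos(t - h) - cos(t + h) = 2 sin h sin t.
  have hAB : (∫ t in (0 : ℝ)..Real.pi, (Real.cos (t + 0) - Real.cos (t + h)) * G t)
      + (∫ t in (0 : ℝ)..Real.pi, (Real.cos (t + -h) - Real.cos (t + 0)) * G t)
      = 2 * Real.sin h * ∫ t in (0 : ℝ)..Real.pi, Real.sin t * G t := by
    rw [← intervalIntegral.integral_add (hint ha _ _) (hint hb _ _),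
      ← intervalIntegral.integral_const_mul]
    congr 1; ext t
    rw [add_zero, Real.cos_add, Real.cos_add, Real.cos_neg, Real.sin_neg]
    ring
  -- It remains to subtract two end pieces of length h. Near 0 and π the cosine is within h²/2 of
  -- its extreme value, so each costs at most h³/2.
  have hmul : ∀ a t : ℝ, a ≤ h ^ 2 / 2 → a * G t ≤ h ^ 2 / 2 := fun a t hat => by
    have h2 : 0 ≤ h ^ 2 / 2 := by positivity
    calc a * G t ≤ h ^ 2 / 2 * G t := mul_le_mul_of_nonneg_right hat (hG0 t)
      _ ≤ h ^ 2 / 2 := mul_le_of_le_one_right h2 (hG1 t)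
  have hA' : ∫ t in (Real.pi - h)..Real.pi, (Real.cos (t + 0) - Real.cos (t + h)) * G t
      ≤ h ^ 3 / 2 := by
    refine (intervalIntegral.integral_mono_on (by linarith) (hint ha _ _)
      (hint (.const (h ^ 2 / 2)) _ _) fun t ht => hmul _ t ?_).trans_eq ?_
    · have h1 := Real.one_sub_sq_div_two_le_cos (x := Real.pi - t)
      rw [Real.cos_pi_sub] at h1
      have h2 := Real.neg_one_le_cos (t + h)
      have h3 : (Real.pi - t) ^ 2 ≤ h ^ 2 :=
        pow_le_pow_left₀ (by linarith [ht.2]) (by linarith [ht.1]) 2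
      rw [add_zero]
      linarith
    · rw [intervalIntegral.integral_const, smul_eq_mul]; ring
  have hB' : ∫ t in (0 : ℝ)..h, (Real.cos (t + -h) - Real.cos (t + 0)) * G t ≤ h ^ 3 / 2 := by
    refine (intervalIntegral.integral_mono_on hh.le (hint hb _ _)
      (hint (.const (h ^ 2 / 2)) _ _) fun t ht => hmul _ t ?_).trans_eq ?_
    · have h1 := Real.one_sub_sq_div_two_le_cos (x := t)
      have h2 := Real.cos_le_one (t + -h)
      have h3 : t ^ 2 ≤ h ^ 2 := pow_le_pow_left₀ ht.1 ht.2 2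
      rw [add_zero]
      linarith
    · rw [intervalIntegral.integral_const, smul_eq_mul]; ring
  rw [hsum, hsplit]
  linarith

theorem sectionLength_le_one {K : Set (ℝ × ℝ)} (hKs : K ⊆ unitSquare) (x : ℝ) :
    sectionLength K x ≤ 1 := by
  have hsub : Prod.mk x ⁻¹' K ⊆ Set.Icc (0 : ℝ) 1 := fun y hy => (hKs hy).2
  have := measureReal_mono hsub (measure_Icc_lt_top (μ := volume)).ne
  simpa [sectionLength] using this

theorem boundedMeasurable_sectionLength {K : Set (ℝ × ℝ)} (hK : IsCompact K)
    (hKs : K ⊆ unitSquare) : BoundedMeasurable (sectionLength K) :=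
  ⟨(measurable_measure_prodMk_left hK.measurableSet).ennreal_toReal, 1, fun x => by
    rw [abs_of_nonneg (sectionLength_nonneg K x)]
    exact sectionLength_le_one hKs x⟩

theorem volume_unitSquare : volume.real unitSquare = 1 := by
  rw [unitSquare, Measure.volume_eq_prod, measureReal_prod_prod]
  simp

theorem isCompact_unitSquare : IsCompact unitSquare := isCompact_Icc.prod isCompact_Icc

theorem volume_le_one {K : Set (ℝ × ℝ)} (hKs : K ⊆ unitSquare) : volume.real K ≤ 1 :=
  (measureReal_mono hKs isCompact_unitSquare.measure_lt_top.ne).trans_eq volume_unitSquare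

theorem convexHull_mem_polygons {s : Finset (ℝ × ℝ)} (hs : s.Nonempty) {m : ℕ} (hm : s.card ≤ m)
    (hsq : convexHull ℝ (s : Set (ℝ × ℝ)) ⊆ unitSquare) :
    convexHull ℝ (s : Set (ℝ × ℝ)) ∈ polygons m := by
  refine ⟨⟨s, s.finite_toSet, hs, rfl⟩, hsq, ?_⟩
  refine (Set.ncard_le_ncard extremePoints_convexHull_subset s.finite_toSet).trans ?_
  rwa [Set.ncard_coe_finset]

/-- The trapezoid sum over cosine nodes of a convex set is bounded by the area of an inscribed
polygon. -/
theorem exists_polygon_sum_trapezoid_le {K : Set (ℝ × ℝ)} (hK : IsCompact K) (hK' : Convex ℝ K)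
    (hKs : K ⊆ unitSquare) {c r : ℝ} (hr : 0 < r)
    (hproj : Prod.fst '' K = Set.Icc (c - r) (c + r)) {h : ℝ} (hh : 0 < h) {k m : ℕ}
    (hk : k * h = Real.pi - h) (hm : 2 * (k + 1) ≤ m) {s : ℝ} (hs : s ∈ Set.Icc 0 h) :
    ∃ Q ∈ polygons m, Q ⊆ K ∧
      r / 2 * ∑ i ∈ Finset.range k, (Real.cos (s + i * h) - Real.cos (s + (i + 1) * h)) *
        (sectionLength K (c - r * Real.cos (s + i * h))
          + sectionLength K (c - r * Real.cos (s + (i + 1) * h))) ≤ volume.real Q := by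
  set x : ℕ → ℝ := fun i => c - r * Real.cos (s + i * h) with hx
  have hnode : ∀ i ≤ k, s + i * h ∈ Set.Icc 0 Real.pi := fun i hi => by
    have hi' : (i : ℝ) * h ≤ k * h := by gcongr
    have hi0 : 0 ≤ (i : ℝ) * h := by positivity
    exact ⟨by linarith [hs.1], by linarith [hs.2]⟩
  have hxK : ∀ i, x i ∈ Prod.fst '' K := fun i => by
    rw [hproj]
    have h1 := Real.neg_one_le_cos (s + i * h)
    have h2 := Real.cos_le_one (s + i * h)
    constructor <;> simp only [hx] <;> nlinarith
  choose g f hgf hg hf hlen using fun i => exists_section_endpoints hK hK' (hxK i)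
  -- Both section endpoints at each of the k + 1 nodes: at most 2(k + 1) vertices.
  set S : Finset (ℝ × ℝ) := (Finset.range (k + 1)).image (fun i => (x i, g i)) ∪
    (Finset.range (k + 1)).image (fun i => (x i, f i)) with hS
  have hgS : ∀ i ≤ k, (x i, g i) ∈ S := fun i hi => Finset.mem_union_left _
    (Finset.mem_image_of_mem (fun i => (x i, g i)) (Finset.mem_range.2 (Nat.lt_succ_of_le hi)))
  have hfS : ∀ i ≤ k, (x i, f i) ∈ S := fun i hi => Finset.mem_union_right _
    (Finset.mem_image_of_mem (fun i => (x i, f i)) (Finset.mem_range.2 (Nat.lt_succ_of_le hi)))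
  have hSK : (S : Set (ℝ × ℝ)) ⊆ K := fun p hp => by
    rcases Finset.mem_union.1 hp with hp | hp <;> obtain ⟨i, -, rfl⟩ := Finset.mem_image.1 hp
    exacts [hg i, hf i]
  have hQK : convexHull ℝ (S : Set (ℝ × ℝ)) ⊆ K := convexHull_min hSK hK'
  refine ⟨convexHull ℝ (S : Set (ℝ × ℝ)), convexHull_mem_polygons ⟨_, hgS 0 (Nat.zero_le _)⟩ ?_
    (hQK.trans hKs), hQK, ?_⟩
  · refine (Finset.card_union_le _ _).trans ?_
    have h1 := Finset.card_image_le (s := Finset.range (k + 1)) (f := fun i => (x i, g i))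
    have h2 := Finset.card_image_le (s := Finset.range (k + 1)) (f := fun i => (x i, f i))
    rw [Finset.card_range] at h1 h2
    omega
  · refine le_trans (le_of_eq ?_) (sum_trapezoid_le_volume (S.finite_toSet.isCompact_convexHull (𝕜 := ℝ))
      (convex_convexHull ℝ _) (x := x) (g := g) (f := f) (m := k) (fun i hi => ?_)
      (fun i _ => hgf i) (fun i hi => subset_convexHull ℝ _ (hgS i hi))
      (fun i hi => subset_convexHull ℝ _ (hfS i hi)))
    · rw [Finset.mul_sum]
      refine Finset.sum_congr rfl fun i _ => ?_
      rw [hlen, hlen]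
      simp only [hx]
      push_cast
      ring
    · have := Real.strictAntiOn_cos.antitoneOn (hnode i hi.le) (hnode (i + 1) hi)
        (by push_cast; nlinarith)
      simp only [hx]
      nlinarith

/-- Averaging: suppose that every inscribed polygon loses more than C/m². Integrating the trapezoid
sums over the shift s ∈ [0, h] then gives A sin h - r h³/2 ≤ h (A - C/m²). With sin h > h - h³/4, A
≤ 1 and r ≤ 1/2 this forces C/m² ≤ h²/2. As h is π divided by at least m/3, it would follow that C ≤
45, whereas C > 256. -/
theorem exists_polygon_volume {K : Set (ℝ × ℝ)} (hK : IsCompact K) (hK' : Convex ℝ K)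
    (hKn : K.Nonempty) (hKs : K ⊆ unitSquare) {m : ℕ} (hm : 3 ≤ m) :
    ∃ Q ∈ polygons m, Q ⊆ K ∧
      volume.real K - volume.real Q ≤ (8 * Real.pi ^ 3 + 16 * Real.pi) / (m : ℝ) ^ 2 := by
  have hpi := Real.pi_pos
  have hpi3 := Real.pi_gt_three
  have hpi4 := Real.pi_lt_d2
  have hm0 : (0 : ℝ) < m := by positivity
  set C := 8 * Real.pi ^ 3 + 16 * Real.pi with hC
  have hC256 : 256 < C := by
    have : (3.14 : ℝ) ^ 3 ≤ Real.pi ^ 3 := by gcongr; exact Real.pi_gt_d2.le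
    norm_num at this
    linarith [Real.pi_gt_d2]
  -- If the area is already below the target, a single point suffices. Since C > 256 and the area is
  -- at most 1, this disposes of all m ≤ 16.
  by_cases hvol : volume.real K ≤ C / (m : ℝ) ^ 2
  · obtain ⟨p, hp⟩ := hKn
    have e : convexHull ℝ ((({p} : Finset (ℝ × ℝ))) : Set (ℝ × ℝ)) = {p} := by simp
    refine ⟨_, convexHull_mem_polygons (s := {p}) (by simp) (by simp; omega) ?_, ?_, ?_⟩
    · rw [e]; exact Set.singleton_subset_iff.2 (hKs hp)
    · rw [e]; exact Set.singleton_subset_iff.2 hp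
    · exact (sub_le_self _ measureReal_nonneg).trans hvol
  push Not at hvol
  by_contra! hcon
  have hA1 := volume_le_one hKs
  have hA0 : 0 ≤ volume.real K := measureReal_nonneg
  set A := volume.real K with hA
  have hm16 : 16 < m := by
    by_contra! hle
    have h1 : (m : ℝ) ≤ 16 := by exact_mod_cast hle
    have h2 : (m : ℝ) ^ 2 ≤ 16 ^ 2 := by gcongr
    rw [div_lt_iff₀ (by positivity)] at hvol
    nlinarith
  obtain ⟨α, β, hαβ, hproj⟩ : ∃ α β : ℝ, α ≤ β ∧ Prod.fst '' K = Set.Icc α β := by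
    have hc := hK.image continuous_fst
    have hn : (Prod.fst '' K).Nonempty := hKn.image _
    have hconv : Convex ℝ (Prod.fst '' K) := hK'.linear_image (LinearMap.fst ℝ ℝ ℝ)
    exact ⟨_, _, csInf_le_csSup hn hc.bddBelow hc.bddAbove,
      eq_Icc_of_connected_compact ⟨hn, hconv.ordConnected.isPreconnected⟩ hc⟩
  have hAint : A = ∫ x in Set.Icc α β, sectionLength K x := by
    rw [hA, ← integral_sectionLength hK]
    refine (setIntegral_eq_integral_of_forall_compl_eq_zero fun x hx => ?_).symm
    rw [← hproj] at hx
    have : Prod.mk x ⁻¹' K = ∅ := Set.eq_empty_of_forall_notMem fun y hy => hx ⟨_, hy, rfl⟩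
    rw [sectionLength, this, measureReal_empty]
  have hlt : α < β := by
    refine hαβ.lt_of_ne fun h => ?_
    rw [h, Set.Icc_self, Measure.restrict_singleton] at hAint
    simp at hAint
    have : 0 ≤ C / (m : ℝ) ^ 2 := by positivity
    linarith
  have hαβ1 : β - α ≤ 1 := by
    obtain ⟨p, hp, hpα⟩ : α ∈ Prod.fst '' K := hproj ▸ Set.left_mem_Icc.2 hαβ
    obtain ⟨q, hq, hqβ⟩ : β ∈ Prod.fst '' K := hproj ▸ Set.right_mem_Icc.2 hαβ
    have h1 := (hKs hp).1.1
    have h2 := (hKs hq).1.2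
    linarith
  set c := (α + β) / 2 with hc
  set r := (β - α) / 2 with hr
  have hr0 : 0 < r := by rw [hr]; linarith
  have hr1 : r ≤ 1 / 2 := by rw [hr]; linarith
  have hα : c - r = α := by rw [hc, hr]; ring
  have hβ : c + r = β := by rw [hc, hr]; ring
  set G : ℝ → ℝ := fun t => sectionLength K (c - r * Real.cos t) with hG
  have hGm : BoundedMeasurable G := (boundedMeasurable_sectionLength hK hKs).comp
    (by fun_prop : Continuous fun t : ℝ => c - r * Real.cos t).measurable
  have hAG : A = r * ∫ t in (0 : ℝ)..Real.pi, Real.sin t * G t := by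
    rw [hAint, ← hα, ← hβ, integral_Icc_eq_integral_cos _ _ hr0, integral_Icc_eq_integral_Ioc,
      ← intervalIntegral.integral_of_le hpi.le, ← intervalIntegral.integral_const_mul]
    congr 1; ext t
    simp only [hG]
    ring
  -- k + 1 nodes with two vertices each use at most m vertices. The loss from rounding m/2 down is
  -- covered by m ≤ 3(k + 1).
  obtain ⟨k, hk⟩ : ∃ k, m / 2 = k + 1 := ⟨m / 2 - 1, by omega⟩
  have hk8 : (8 : ℝ) ≤ k + 1 := by exact_mod_cast (by omega : 8 ≤ k + 1)
  have hkm : (m : ℝ) ≤ 3 * (k + 1) := by exact_mod_cast (by omega : m ≤ 3 * (k + 1))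
  set h := Real.pi / (k + 1) with hh
  have hh0 : 0 < h := by positivity
  have hkh : k * h = Real.pi - h := by rw [hh]; field_simp; ring
  have hsin : h - h ^ 3 / 4 < Real.sin h := by
    linarith [Real.sin_gt_sub_cube hh0, pow_pos hh0 3]
  have hlow := le_integral_sum_trapezoid hGm (fun t => sectionLength_nonneg K _)
    (fun t => sectionLength_le_one hKs _) hh0 hkh
  set T : ℝ → ℝ := fun s => ∑ i ∈ Finset.range k,
    (Real.cos (s + i * h) - Real.cos (s + (i + 1) * h)) *
      (G (s + i * h) + G (s + (i + 1) * h)) with hT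
  have hTm : BoundedMeasurable T := by
    have hcos : ∀ c : ℝ, BoundedMeasurable fun t => Real.cos (t + c) := fun c =>
      ⟨(by fun_prop : Continuous fun t : ℝ => Real.cos (t + c)).measurable, 1,
        fun _ => Real.abs_cos_le_one _⟩
    exact .sum fun i => ((hcos _).sub (hcos _)).mul
      ((hGm.comp (measurable_add_const _)).add (hGm.comp (measurable_add_const _)))
  have hup : ∫ s in (0 : ℝ)..h, r / 2 * T s ≤ h * (A - C / (m : ℝ) ^ 2) := by
    have : IntervalIntegrable (fun s => r / 2 * T s) volume 0 h :=
      ⟨((BoundedMeasurable.const _).mul hTm).integrable _,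
        ((BoundedMeasurable.const _).mul hTm).integrable _⟩
    refine (intervalIntegral.integral_mono_on hh0.le this
      (intervalIntegrable_const (c := A - C / (m : ℝ) ^ 2)) fun s hs => ?_).trans_eq
      (by rw [intervalIntegral.integral_const, smul_eq_mul, sub_zero])
    obtain ⟨Q, hQ, hQK, hle⟩ := exists_polygon_sum_trapezoid_le hK hK' hKs hr0
      (by rw [hα, hβ, hproj]) hh0 hkh (by omega : 2 * (k + 1) ≤ m) hs
    have := hcon Q hQ hQK
    have h2 : r / 2 * T s ≤ volume.real Q := hle
    linarith
  rw [intervalIntegral.integral_const_mul] at hup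
  have h1 := (mul_le_mul_of_nonneg_left hlow (by positivity : 0 ≤ r / 2)).trans hup
  have h2 : r / 2 * (2 * Real.sin h * (∫ t in (0 : ℝ)..Real.pi, Real.sin t * G t) - h ^ 3)
      = Real.sin h * A - r / 2 * h ^ 3 := by rw [hAG]; ring
  rw [h2] at h1
  have h3 : h * (C / (m : ℝ) ^ 2) ≤ h * (h ^ 2 / 2) := by
    have h4 : (h - h ^ 3 / 4) * A ≤ Real.sin h * A := mul_le_mul_of_nonneg_right hsin.le hA0
    have h5 : 0 ≤ h ^ 3 := by positivity
    nlinarith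
  have h6 := le_of_mul_le_mul_left h3 hh0
  rw [hh, div_pow, div_div, div_le_div_iff₀ (by positivity) (by positivity)] at h6
  have h7 : (m : ℝ) ^ 2 ≤ (3 * (k + 1)) ^ 2 := by gcongr
  have h8 : Real.pi ^ 2 ≤ 10 := by nlinarith
  have h9 : Real.pi ^ 2 * (m : ℝ) ^ 2 ≤ 10 * (3 * (k + 1)) ^ 2 := by gcongr
  have h10 : (0 : ℝ) < ((k : ℝ) + 1) ^ 2 := by positivity
  nlinarith

/-! ### Moments of a difference of indicators -/

instance isProbabilityMeasure_unitVolume : IsProbabilityMeasure unitVolume :=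
  ⟨by simp⟩

theorem unitVolume_prod : unitVolume.prod unitVolume = volume.restrict unitSquare := by
  rw [Measure.prod_restrict, ← Measure.volume_eq_prod, unitSquare]

/-- The difference of two indicator functions. -/
noncomputable def indicatorDiff (K P : Set (ℝ × ℝ)) (z : ℝ × ℝ) : ℝ :=
  K.indicator (1 : ℝ × ℝ → ℝ) z - P.indicator (1 : ℝ × ℝ → ℝ) z

theorem boundedMeasurable_indicator_one {α : Type*} [MeasurableSpace α] {s : Set α}
    (hs : MeasurableSet s) : BoundedMeasurable (s.indicator (1 : α → ℝ)) :=
  ⟨measurable_one.indicator hs, 1, fun t => by by_cases ht : t ∈ s <;> simp [ht]⟩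

theorem boundedMeasurable_indicatorDiff {K P : Set (ℝ × ℝ)} (hK : IsCompact K)
    (hP : IsCompact P) : BoundedMeasurable (indicatorDiff K P) :=
  (boundedMeasurable_indicator_one hK.measurableSet).sub
    (boundedMeasurable_indicator_one hP.measurableSet)

theorem nikodymDist_eq_integral {K P : Set (ℝ × ℝ)} (hK : IsCompact K) (hP : IsCompact P)
    (hKs : K ⊆ unitSquare) (hPs : P ⊆ unitSquare) :
    nikodymDist P K = ∫ z, indicatorDiff K P z ^ 2 ∂(unitVolume.prod unitVolume) := by
  have hmeas : MeasurableSet ((P \ K) ∪ (K \ P)) :=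
    (hP.measurableSet.diff hK.measurableSet).union (hK.measurableSet.diff hP.measurableSet)
  have e : (fun z => indicatorDiff K P z ^ 2) = ((P \ K) ∪ (K \ P)).indicator 1 := by
    ext z
    by_cases h1 : z ∈ K <;> by_cases h2 : z ∈ P <;> simp [indicatorDiff, h1, h2]
  have hsub : (P \ K) ∪ (K \ P) ⊆ unitSquare :=
    Set.union_subset (Set.sdiff_subset.trans hPs) (Set.sdiff_subset.trans hKs)
  rw [e, integral_indicator_one hmeas, unitVolume_prod, measureReal_restrict_apply hmeas,
    Set.inter_eq_left.2 hsub, nikodymDist]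

theorem setIntegral_eq_integral_indicator_mul {K : Set (ℝ × ℝ)} (hK : IsCompact K)
    (hKs : K ⊆ unitSquare) (F : ℝ × ℝ → ℝ) :
    ∫ z in K, F z = ∫ z, F z * K.indicator (1 : ℝ × ℝ → ℝ) z ∂(unitVolume.prod unitVolume) := by
  have e : (fun z => F z * K.indicator (1 : ℝ × ℝ → ℝ) z) = K.indicator F := by
    ext z; by_cases h : z ∈ K <;> simp [h]
  rw [e, integral_indicator hK.measurableSet, unitVolume_prod,
    Measure.restrict_restrict hK.measurableSet, Set.inter_eq_left.2 hKs]

/-- Polynomials are generally unbounded on the line, while the tensor product lemmas ask for global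
bounds. Cutting off outside [0, 1] supplies these and leaves integrals against `unitVolume`
unchanged. -/
theorem boundedMeasurable_indicator_Icc {f : ℝ → ℝ} (hf : Continuous f) :
    BoundedMeasurable ((Set.Icc (0 : ℝ) 1).indicator f) := by
  obtain ⟨C, hC⟩ := (isCompact_Icc (a := (0 : ℝ)) (b := 1)).exists_bound_of_continuousOn
    hf.continuousOn
  refine ⟨hf.measurable.indicator measurableSet_Icc, max C 0, fun x => ?_⟩
  by_cases hx : x ∈ Set.Icc (0 : ℝ) 1
  · rw [Set.indicator_of_mem hx]; exact (hC x hx).trans (le_max_left _ _)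
  · rw [Set.indicator_of_notMem hx, abs_zero]; exact le_max_right _ _

theorem integral_indicator_Icc_mul (f h : ℝ → ℝ) :
    ∫ x, (Set.Icc (0 : ℝ) 1).indicator f x * h x ∂unitVolume = ∫ x, f x * h x ∂unitVolume :=
  setIntegral_congr_fun measurableSet_Icc fun x hx => by
    simp only [Set.indicator_of_mem hx]

theorem moment_sub_moment {φ : ℕ → ℝ → ℝ} (hφ : ∀ i, Continuous (φ i)) {K P : Set (ℝ × ℝ)}
    (hK : IsCompact K) (hP : IsCompact P) (hKs : K ⊆ unitSquare) (hPs : P ⊆ unitSquare)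
    (i j : ℕ) :
    (∫ z in K, φ i z.1 * φ j z.2) - ∫ z in P, φ i z.1 * φ j z.2
      = ∫ z, (Set.Icc (0 : ℝ) 1).indicator (φ i) z.1 * (Set.Icc (0 : ℝ) 1).indicator (φ j) z.2 *
          indicatorDiff K P z ∂(unitVolume.prod unitVolume) := by
  have hm : ∀ s : Set (ℝ × ℝ), IsCompact s → BoundedMeasurable fun z : ℝ × ℝ =>
      (Set.Icc (0 : ℝ) 1).indicator (φ i) z.1 * (Set.Icc (0 : ℝ) 1).indicator (φ j) z.2 *
        s.indicator (1 : ℝ × ℝ → ℝ) z := fun s hs =>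
    (((boundedMeasurable_indicator_Icc (hφ i)).comp measurable_fst).mul
      ((boundedMeasurable_indicator_Icc (hφ j)).comp measurable_snd)).mul
      (boundedMeasurable_indicator_one hs.measurableSet)
  have he : ∀ s : Set (ℝ × ℝ), IsCompact s → s ⊆ unitSquare → ∫ z in s, φ i z.1 * φ j z.2
      = ∫ z, (Set.Icc (0 : ℝ) 1).indicator (φ i) z.1 * (Set.Icc (0 : ℝ) 1).indicator (φ j) z.2 *
        s.indicator (1 : ℝ × ℝ → ℝ) z ∂(unitVolume.prod unitVolume) := fun s hs hss => by
    rw [← setIntegral_eq_integral_indicator_mul hs hss]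
    refine setIntegral_congr_fun hs.measurableSet fun z hz => ?_
    have := hss hz
    simp only [Set.indicator_of_mem this.1, Set.indicator_of_mem this.2]
  rw [he K hK hKs, he P hP hPs, ← integral_sub ((hm K hK).integrable _) ((hm P hP).integrable _)]
  simp only [indicatorDiff, mul_sub]

theorem sum_sq_moment_sub_le {φ : ℕ → ℝ → ℝ} (hφ : ∀ i, Continuous (φ i)) {C : ℝ} (hC : 0 ≤ C)
    {n : ℕ} (hB : ∀ h : ℝ → ℝ, BoundedMeasurable h →
      ∑ i ∈ Finset.range n, (∫ x, φ i x * h x ∂unitVolume) ^ 2 ≤ C * ∫ x, h x ^ 2 ∂unitVolume)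
    {K P : Set (ℝ × ℝ)} (hK : IsCompact K) (hP : IsCompact P) (hKs : K ⊆ unitSquare)
    (hPs : P ⊆ unitSquare) :
    ∑ i ∈ Finset.range n, ∑ j ∈ Finset.range n,
      ((∫ z in K, φ i z.1 * φ j z.2) - ∫ z in P, φ i z.1 * φ j z.2) ^ 2
        ≤ C ^ 2 * nikodymDist P K := by
  simp_rw [moment_sub_moment hφ hK hP hKs hPs, nikodymDist_eq_integral hK hP hKs hPs]
  refine sum_sq_integral_prod_le (fun i => boundedMeasurable_indicator_Icc (hφ i)) hC
    (fun h hh => ?_) (boundedMeasurable_indicatorDiff hK hP)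
  simp_rw [integral_indicator_Icc_mul]
  exact hB h hh

/-- The Hilbert constant 4 enters once per variable, whence 16, uniformly in N. -/
theorem geometricMomentError_le {K P : Set (ℝ × ℝ)} (hK : IsCompact K) (hP : IsCompact P)
    (hKs : K ⊆ unitSquare) (hPs : P ⊆ unitSquare) (N : ℕ) :
    momentError geometricMoment N K P ≤ 16 * nikodymDist P K := by
  have := sum_sq_moment_sub_le (φ := fun i x => x ^ i) (fun i => continuous_pow i) (C := 4)
    (by norm_num) (n := N + 1) (fun h hh => sum_sq_integral_pow_mul_le (hh.memLp _) (N + 1))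
    hK hP hKs hPs
  norm_num at this
  exact this

theorem integral_indicator_legendre_mul (i j : ℕ) :
    ∫ x, (Set.Icc (0 : ℝ) 1).indicator (fun x => (legendre i).eval x) x *
      (Set.Icc (0 : ℝ) 1).indicator (fun x => (legendre j).eval x) x ∂unitVolume
      = if i = j then 1 else 0 := by
  rw [integral_indicator_Icc_mul, ← integral_legendre_mul_legendre, ← integral_unitVolume]
  exact setIntegral_congr_fun measurableSet_Icc fun x hx => by
    simp only [Set.indicator_of_mem hx]

theorem legendreMomentError_le {K P : Set (ℝ × ℝ)} (hK : IsCompact K) (hP : IsCompact P)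
    (hKs : K ⊆ unitSquare) (hPs : P ⊆ unitSquare) (N : ℕ) :
    momentError legendreMoment N K P ≤ nikodymDist P K := by
  have := sum_sq_moment_sub_le (φ := fun i x => (legendre i).eval x)
    (fun i => (legendre i).continuous) (C := 1) zero_le_one (n := N + 1) (fun h hh => ?_)
    hK hP hKs hPs
  · rw [one_pow, one_mul] at this
    exact this
  · have h1 := sum_sq_integral_mul_le
      (fun i => boundedMeasurable_indicator_Icc (legendre i).continuous)
      integral_indicator_legendre_mul hh (N + 1)
    simp_rw [integral_indicator_Icc_mul] at h1
    rwa [one_mul]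

/-! ### The polynomial tail -/

/-- Compare with the difference of the polynomials approximating the two intervals. By (a - b)² ≤
2a² + 2b² the error is at most (2 · 3 + 2 · 3)/(N+1). -/
theorem integral_sq_indicator_sub_indicator_le {I J : Set ℝ} (hI : IsCompact I)
    (hI' : I.OrdConnected) (hJ : IsCompact J) (hJ' : J.OrdConnected) (N : ℕ) :
    ∫ x, (I.indicator (1 : ℝ → ℝ) x - J.indicator (1 : ℝ → ℝ) x) ^ 2 ∂unitVolume
      - ∑ i ∈ Finset.range (N + 1), (∫ x, (Set.Icc (0 : ℝ) 1).indicator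
          (fun x => (legendre i).eval x) x *
            (I.indicator (1 : ℝ → ℝ) x - J.indicator (1 : ℝ → ℝ) x) ∂unitVolume) ^ 2
      ≤ 12 / (N + 1) := by
  obtain ⟨p, hp, hpI⟩ := exists_polynomial_approx hI hI' N
  obtain ⟨q, hq, hqJ⟩ := exists_polynomial_approx hJ hJ' N
  obtain ⟨b, hb⟩ := exists_eq_sum_legendre
    ((Polynomial.natDegree_sub_le p q).trans (max_le hp hq))
  have hIm := boundedMeasurable_indicator_one hI.measurableSet
  have hJm := boundedMeasurable_indicator_one hJ.measurableSet
  refine (integral_sq_sub_sum_sq_le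
    (fun i => boundedMeasurable_indicator_Icc (legendre i).continuous)
    integral_indicator_legendre_mul (hIm.sub hJm) (N + 1) b).trans ?_
  have hint : ∀ {s : Set ℝ}, IsCompact s → ∀ p : Polynomial ℝ,
      Integrable (fun x => 2 * (s.indicator (1 : ℝ → ℝ) x - p.eval x) ^ 2) unitVolume :=
    fun hs p => (((boundedMeasurable_indicator_one hs.measurableSet).memLp _).sub
      (memLp_unitVolume_of_continuous p.continuous)).integrable_sq.const_mul 2
  calc _ ≤ ∫ x, (2 * (I.indicator (1 : ℝ → ℝ) x - p.eval x) ^ 2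
        + 2 * (J.indicator (1 : ℝ → ℝ) x - q.eval x) ^ 2) ∂unitVolume := by
        refine integral_mono_of_nonneg (Filter.Eventually.of_forall fun x => sq_nonneg _)
          ((hint hI p).add (hint hJ q))
          ((ae_restrict_iff' measurableSet_Icc).2 (Filter.Eventually.of_forall fun x hx => ?_))
        have := hb x
        rw [Polynomial.eval_sub] at this
        simp only [Set.indicator_of_mem hx]
        rw [← this]
        nlinarith [sq_nonneg ((I.indicator (1 : ℝ → ℝ) x - p.eval x)
          + (J.indicator (1 : ℝ → ℝ) x - q.eval x))]
    _ ≤ (12 : ℝ) / (N + 1) := by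
        rw [integral_add (hint hI p) (hint hJ q), integral_const_mul, integral_const_mul]
        have : (12 : ℝ) / (N + 1) = 2 * (3 / (N + 1)) + 2 * (3 / (N + 1)) := by ring
        linarith

theorem convex_preimage_mk_right {K : Set (ℝ × ℝ)} (hK : Convex ℝ K) (y : ℝ) :
    Convex ℝ ((fun x => (x, y)) ⁻¹' K) := fun a ha b hb s t hs ht hst => by
  have := hK ha hb hs ht hst
  simpa [← add_mul, hst] using this

theorem isCompact_preimage_mk_right {K : Set (ℝ × ℝ)} (hK : IsCompact K) (y : ℝ) :
    IsCompact ((fun x => (x, y)) ⁻¹' K) :=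
  (hK.image continuous_fst).of_isClosed_subset
    (hK.isClosed.preimage (by fun_prop)) fun x hx => ⟨(x, y), hx, rfl⟩

/-- Convexity enters here through the slices, which are compact intervals in both directions. Each
direction contributes 12/(N+1) to the tail. -/
theorem nikodymDist_le_legendreMomentError_add {K P : Set (ℝ × ℝ)} (hK : IsCompact K)
    (hP : IsCompact P) (hK' : Convex ℝ K) (hP' : Convex ℝ P) (hKs : K ⊆ unitSquare)
    (hPs : P ⊆ unitSquare) (N : ℕ) :
    nikodymDist P K ≤ momentError legendreMoment N K P + 24 / (N + 1) := by
  have h := integral_sq_le_sum_add (μ := unitVolume) (n := N + 1) (ε := 12 / (N + 1))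
    (fun i => boundedMeasurable_indicator_Icc (legendre i).continuous)
    integral_indicator_legendre_mul (boundedMeasurable_indicatorDiff hK hP)
    (fun y => integral_sq_indicator_sub_indicator_le (isCompact_preimage_mk_right hK y)
      (convex_preimage_mk_right hK' y).ordConnected (isCompact_preimage_mk_right hP y)
      (convex_preimage_mk_right hP' y).ordConnected N)
    (fun x => integral_sq_indicator_sub_indicator_le (isCompact_section hK x)
      (convex_preimage_mk_left hK' x).ordConnected (isCompact_section hP x)
      (convex_preimage_mk_left hP' x).ordConnected N)
  simp_rw [← moment_sub_moment (fun i => (legendre i).continuous) hK hP hKs hPs] at h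
  rw [← nikodymDist_eq_integral hK hP hKs hPs] at h
  refine h.trans_eq ?_
  rw [momentError]
  simp only [legendreMoment]
  ring

/-! ### Comparison of Legendre and geometric moments -/

theorem legendreMoment_eq_sum {K : Set (ℝ × ℝ)} (hK : IsCompact K) {n i j : ℕ} (hi : i ≤ n)
    (hj : j ≤ n) :
    legendreMoment i j K = ∑ k ∈ Finset.range (n + 1), (legendre i).coeff k *
      ∑ l ∈ Finset.range (n + 1), (legendre j).coeff l * geometricMoment k l K := by
  have hint : ∀ k l : ℕ, IntegrableOn (fun z : ℝ × ℝ =>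
      (legendre i).coeff k * ((legendre j).coeff l * (z.1 ^ k * z.2 ^ l))) K := fun k l =>
    ((by fun_prop : Continuous fun z : ℝ × ℝ => (legendre i).coeff k *
      ((legendre j).coeff l * (z.1 ^ k * z.2 ^ l))).continuousOn).integrableOn_compact hK
  have e : ∀ z : ℝ × ℝ, (legendre i).eval z.1 * (legendre j).eval z.2
      = ∑ k ∈ Finset.range (n + 1), ∑ l ∈ Finset.range (n + 1),
        (legendre i).coeff k * ((legendre j).coeff l * (z.1 ^ k * z.2 ^ l)) := fun z => by
    rw [Polynomial.eval_eq_sum_range' (Nat.lt_succ_of_le ((natDegree_legendre_le i).trans hi)),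
      Polynomial.eval_eq_sum_range' (Nat.lt_succ_of_le ((natDegree_legendre_le j).trans hj)),
      Finset.sum_mul_sum]
    exact Finset.sum_congr rfl fun k _ => Finset.sum_congr rfl fun l _ => by ring
  rw [legendreMoment]
  simp_rw [e]
  rw [integral_finsetSum _ fun k _ => integrable_finsetSum _ fun l _ => hint k l]
  refine Finset.sum_congr rfl fun k _ => ?_
  rw [integral_finsetSum _ fun l _ => hint k l, Finset.mul_sum]
  refine Finset.sum_congr rfl fun l _ => ?_
  rw [integral_const_mul, integral_const_mul, geometricMoment]

/-- The change from geometric to Legendre moments is a tensor square, so the one-dimensional bound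
is applied once in each index. -/
theorem legendreMomentError_le_geometricMomentError {K P : Set (ℝ × ℝ)} (hK : IsCompact K)
    (hP : IsCompact P) (n : ℕ) :
    momentError legendreMoment n K P
      ≤ (4608 ^ (n + 1)) ^ 2 * momentError geometricMoment n K P := by
  set u : ℕ → ℕ → ℝ := fun k l => geometricMoment k l K - geometricMoment k l P with hu
  set v : ℕ → ℕ → ℝ := fun j k => ∑ l ∈ Finset.range (n + 1), (legendre j).coeff l * u k l with hv
  have hd : ∀ i ∈ Finset.range (n + 1), ∀ j ∈ Finset.range (n + 1),
      legendreMoment i j K - legendreMoment i j P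
        = ∑ k ∈ Finset.range (n + 1), (legendre i).coeff k * v j k := fun i hi j hj => by
    rw [legendreMoment_eq_sum hK (Nat.lt_succ_iff.1 (Finset.mem_range.1 hi))
        (Nat.lt_succ_iff.1 (Finset.mem_range.1 hj)),
      legendreMoment_eq_sum hP (Nat.lt_succ_iff.1 (Finset.mem_range.1 hi))
        (Nat.lt_succ_iff.1 (Finset.mem_range.1 hj)), ← Finset.sum_sub_distrib]
    refine Finset.sum_congr rfl fun k _ => ?_
    rw [← mul_sub, ← Finset.sum_sub_distrib]
    simp only [hv, hu, mul_sub]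
  calc momentError legendreMoment n K P
      = ∑ i ∈ Finset.range (n + 1), ∑ j ∈ Finset.range (n + 1),
          (∑ k ∈ Finset.range (n + 1), (legendre i).coeff k * v j k) ^ 2 :=
        Finset.sum_congr rfl fun i hi => Finset.sum_congr rfl fun j hj => by rw [hd i hi j hj]
    _ = ∑ j ∈ Finset.range (n + 1), ∑ i ∈ Finset.range (n + 1),
          (∑ k ∈ Finset.range (n + 1), (legendre i).coeff k * v j k) ^ 2 := Finset.sum_comm
    _ ≤ ∑ j ∈ Finset.range (n + 1), 4608 ^ (n + 1) * ∑ k ∈ Finset.range (n + 1), v j k ^ 2 :=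
        Finset.sum_le_sum fun j _ => sum_sq_legendre_coeff_mul_le n (v j)
    _ = 4608 ^ (n + 1) * ∑ k ∈ Finset.range (n + 1), ∑ j ∈ Finset.range (n + 1), v j k ^ 2 := by
        rw [← Finset.mul_sum, Finset.sum_comm]
    _ ≤ 4608 ^ (n + 1) * ∑ k ∈ Finset.range (n + 1),
          4608 ^ (n + 1) * ∑ l ∈ Finset.range (n + 1), u k l ^ 2 := by
        refine mul_le_mul_of_nonneg_left (Finset.sum_le_sum fun k _ => ?_) (by positivity)
        exact sum_sq_legendre_coeff_mul_le n (u k)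
    _ = (4608 ^ (n + 1)) ^ 2 * momentError geometricMoment n K P := by
        rw [← Finset.mul_sum, momentError]
        ring

theorem momentError_mono (M : ℕ → ℕ → Set (ℝ × ℝ) → ℝ) {n N : ℕ} (h : n ≤ N)
    (K P : Set (ℝ × ℝ)) : momentError M n K P ≤ momentError M N K P := by
  have hsub : Finset.range (n + 1) ⊆ Finset.range (N + 1) := Finset.range_mono (by omega)
  refine (Finset.sum_le_sum fun i _ => Finset.sum_le_sum_of_subset_of_nonneg hsub
    fun j _ _ => sq_nonneg _).trans ?_
  exact Finset.sum_le_sum_of_subset_of_nonneg hsub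
    fun i _ _ => Finset.sum_nonneg fun j _ => sq_nonneg _

/-! ### Least squares estimators -/

theorem isCompact_of_mem_polygons {m : ℕ} {P : Set (ℝ × ℝ)} (hP : P ∈ polygons m) :
    IsCompact P := by
  obtain ⟨⟨s, hs, -, rfl⟩, -⟩ := hP
  exact hs.isCompact_convexHull (𝕜 := ℝ)

theorem convex_of_mem_polygons {m : ℕ} {P : Set (ℝ × ℝ)} (hP : P ∈ polygons m) :
    Convex ℝ P := by
  obtain ⟨⟨s, -, -, rfl⟩, -⟩ := hP
  exact convex_convexHull ℝ s

theorem exists_polygon_nikodymDist_le {K : Set (ℝ × ℝ)} (hK : IsConvexBody K)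
    (hKs : K ⊆ unitSquare) {m : ℕ} (hm : 3 ≤ m) :
    ∃ Q ∈ polygons m, nikodymDist Q K ≤ (8 * Real.pi ^ 3 + 16 * Real.pi) / (m : ℝ) ^ 2 := by
  obtain ⟨hKc, hK', hKi⟩ := hK
  obtain ⟨Q, hQ, hQK, h⟩ := exists_polygon_volume hKc hK' (hKi.mono interior_subset) hKs hm
  refine ⟨Q, hQ, le_of_eq_of_le ?_ h⟩
  rw [nikodymDist, Set.sdiff_eq_empty.2 hQK, Set.empty_union,
    measureReal_sdiff hQK (isCompact_of_mem_polygons hQ).measurableSet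
      hKc.measure_lt_top.ne]

theorem nikodymDist_le_of_legendre {K : Set (ℝ × ℝ)} (hK : IsConvexBody K)
    (hKs : K ⊆ unitSquare) {m N : ℕ} (hm : 3 ≤ m) {P : Set (ℝ × ℝ)}
    (hP : IsLeastSquaresEstimator legendreMoment N m K P) :
    nikodymDist P K ≤ (8 * Real.pi ^ 3 + 16 * Real.pi) / (m : ℝ) ^ 2 + 24 / ((N : ℝ) + 1) := by
  obtain ⟨Q, hQ, hQK⟩ := exists_polygon_nikodymDist_le hK hKs hm
  have h1 := nikodymDist_le_legendreMomentError_add hK.1 (isCompact_of_mem_polygons hP.1) hK.2.1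
    (convex_of_mem_polygons hP.1) hKs hP.1.2.1 N
  have h2 := hP.2 Q hQ
  have h3 := legendreMomentError_le hK.1 (isCompact_of_mem_polygons hQ) hKs hQ.2.1 N
  linarith

/-- The costly change of basis is made only up to degree n. Minimality is used at the full order N,
where the error of `Q` is controlled independently of N, and the error of order n is at most that of
order N. -/
theorem nikodymDist_le_of_geometric {K : Set (ℝ × ℝ)} (hK : IsConvexBody K)
    (hKs : K ⊆ unitSquare) {m N : ℕ} (hm : 3 ≤ m) {P : Set (ℝ × ℝ)}
    (hP : IsLeastSquaresEstimator geometricMoment N m K P) {n : ℕ} (hn : n ≤ N) :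
    nikodymDist P K ≤ (4608 ^ (n + 1)) ^ 2 *
      (16 * ((8 * Real.pi ^ 3 + 16 * Real.pi) / (m : ℝ) ^ 2)) + 24 / ((n : ℝ) + 1) := by
  obtain ⟨Q, hQ, hQK⟩ := exists_polygon_nikodymDist_le hK hKs hm
  have h1 := nikodymDist_le_legendreMomentError_add hK.1 (isCompact_of_mem_polygons hP.1) hK.2.1
    (convex_of_mem_polygons hP.1) hKs hP.1.2.1 n
  have h2 := legendreMomentError_le_geometricMomentError hK.1 (isCompact_of_mem_polygons hP.1) n
  have h3 := (momentError_mono geometricMoment hn K P).trans (hP.2 Q hQ)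
  have h4 := geometricMomentError_le hK.1 (isCompact_of_mem_polygons hQ) hKs hQ.2.1 N
  have h5 : momentError geometricMoment n K P
      ≤ 16 * ((8 * Real.pi ^ 3 + 16 * Real.pi) / (m : ℝ) ^ 2) := by linarith
  have h6 := mul_le_mul_of_nonneg_left h5 (by positivity : (0 : ℝ) ≤ (4608 ^ (n + 1)) ^ 2)
  linarith

/-- Since 4608² ≤ e^21 = (e^7)³, dividing the degree by three compensates for the large base. -/
theorem pow_le_exp_seven_mul (n : ℕ) :
    ((4608 : ℝ) ^ (n / 3 + 1)) ^ 2 ≤ 4608 ^ 2 * Real.exp (7 * ((n : ℝ) + 1)) := by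
  have h1 : (4608 : ℝ) ^ 2 ≤ Real.exp 1 ^ 21 := by
    have : (2.7 : ℝ) ^ 21 ≤ Real.exp 1 ^ 21 := by
      gcongr
      exact (by norm_num : (2.7 : ℝ) ≤ 2.7182818283).trans Real.exp_one_gt_d9.le
    refine le_trans ?_ this
    norm_num
  have h2 : ((n / 3 : ℕ) : ℝ) * 3 ≤ n := by exact_mod_cast Nat.div_mul_le_self n 3
  calc ((4608 : ℝ) ^ (n / 3 + 1)) ^ 2 = 4608 ^ 2 * (4608 ^ 2) ^ (n / 3) := by
        rw [← pow_mul, ← pow_mul, ← pow_add]; congr 1; ring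
    _ ≤ 4608 ^ 2 * (Real.exp 1 ^ 21) ^ (n / 3) := by gcongr
    _ = 4608 ^ 2 * Real.exp (21 * (n / 3 : ℕ)) := by
        rw [← pow_mul, ← Real.exp_nat_mul, mul_one]
        push_cast
        rfl
    _ ≤ 4608 ^ 2 * Real.exp (7 * ((n : ℝ) + 1)) := by
        exact mul_le_mul_of_nonneg_left (Real.exp_le_exp.2 (by linarith)) (by positivity)

end MomentLSQ

theorem mainTheorem6 :
    ∃ a₀ : ℝ, 0 < a₀ ∧ ∃ a₁ : ℝ, 0 < a₁ ∧
      ∀ K : Set (ℝ × ℝ), MomentLSQ.IsConvexBody K → K ⊆ MomentLSQ.unitSquare →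
      ∀ m : ℕ, 3 ≤ m → ∀ N : ℕ,
        (∀ P : Set (ℝ × ℝ),
          MomentLSQ.IsLeastSquaresEstimator MomentLSQ.geometricMoment N m K P →
          ∀ n : ℕ, n ≤ N →
            MomentLSQ.nikodymDist P K ≤
              a₀ * ((n : ℝ) + 1) ^ 2 * Real.exp (7 * ((n : ℝ) + 1)) *
                (1 + 1 / 2 * Real.log (2 * (n : ℝ) + 1)) ^ 2 *
                ((8 * Real.pi ^ 3 + 16 * Real.pi) / (m : ℝ) ^ 2) +
              a₁ / ((n : ℝ) + 1)) ∧
        (∀ P : Set (ℝ × ℝ),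
          MomentLSQ.IsLeastSquaresEstimator MomentLSQ.legendreMoment N m K P →
            MomentLSQ.nikodymDist P K ≤
              (8 * Real.pi ^ 3 + 16 * Real.pi) / (m : ℝ) ^ 2 + a₁ / ((N : ℝ) + 1)) := by
  -- 16 is the squared Hilbert constant and 4608² comes from the extra 1 in n/3 + 1. The value 72 =
  -- 3 · 24 pays for evaluating the tail at n/3, through n + 1 ≤ 3(n/3 + 1).
  refine ⟨16 * 4608 ^ 2, by norm_num, 72, by norm_num, fun K hK hKs m hm N =>
    ⟨fun P hP n hn => ?_, fun P hP => ?_⟩⟩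
  · refine (MomentLSQ.nikodymDist_le_of_geometric hK hKs hm hP
      ((Nat.div_le_self n 3).trans hn)).trans (add_le_add ?_ ?_)
    · have hpi := Real.pi_pos
      set C := (8 * Real.pi ^ 3 + 16 * Real.pi) / (m : ℝ) ^ 2
      have hC : 0 ≤ C := by positivity
      have h1 : (1 : ℝ) ≤ ((n : ℝ) + 1) ^ 2 := one_le_pow₀ (by linarith [n.cast_nonneg (α := ℝ)])
      have hlog : 0 ≤ Real.log (2 * (n : ℝ) + 1) :=
        Real.log_nonneg (by linarith [n.cast_nonneg (α := ℝ)])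
      have h2 : (1 : ℝ) ≤ (1 + 1 / 2 * Real.log (2 * (n : ℝ) + 1)) ^ 2 :=
        one_le_pow₀ (by linarith)
      set E := Real.exp (7 * ((n : ℝ) + 1))
      have hE : 0 ≤ E := (Real.exp_pos _).le
      calc ((4608 : ℝ) ^ (n / 3 + 1)) ^ 2 * (16 * C) ≤ 4608 ^ 2 * E * (16 * C) :=
            mul_le_mul_of_nonneg_right (MomentLSQ.pow_le_exp_seven_mul n) (by positivity)
        _ = 16 * 4608 ^ 2 * 1 * E * 1 * C := by ring
        _ ≤ _ := by gcongr
    · rw [div_le_div_iff₀ (by positivity) (by positivity)]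
      have : (n : ℝ) + 1 ≤ 3 * ((n / 3 : ℕ) + 1) := by
        exact_mod_cast (by omega : n + 1 ≤ 3 * (n / 3 + 1))
      linarith
  · refine (MomentLSQ.nikodymDist_le_of_legendre hK hKs hm hP).trans (add_le_add le_rfl ?_)
    gcongr
    norm_num
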